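/- For an additive abelian group $G$, let $\mathcal B(G)$ be the monoid of zero-sum sequences over $G$, that is, of all finite unordered sequences (multisets) of elements of $G$, repetition allowed, whose sum is $0$, with concatenation as operation. For a non-invertible (that is, non-empty) $A\in\mathcal B(G)$ let $\mathsf L(A)$ be the set of all $k\in\mathbb N$ such that $A$ is a product of $k$ irreducible elements of $\mathcal B(G)$, set $\mathsf L(1)=\{0\}$ for the empty sequence $1$, and let $\mathcal L(G)=\{\mathsf L(A)\mid A\in\mathcal B(G)\}$. Here $\mathbb N=\{1,2,\dots\}$, $\mathbb N_0=\mathbb N\cup\{0\}$, $[a,b]=\{x\in\mathbb Z\mid a\le x\le b\}$ for integers $a \le b$, $y+L=\{y+x\mid x\in L\}$, $L+L'=\{x+x'\mid x\in L,\ x'\in L'\}$ and $d\cdot L=\{dx\mid x\in L\}$. Let $C_2^4$ be the elementary abelian $2$-group of rank $4$. Then $$\mathcal L(C_2^4)=\mathcal L_1\cup\mathcal L_2\cup\mathcal L_3\cup\mathcal L_4\cup\mathcal L_5\cup\mathcal L_6\cup\mathcal L_7\cup\mathcal L_8,$$ where \begin{align*} \mathcal L_1&=\big\{\{y\}\mid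 y\in\mathbb N_0\big\},\\ \mathcal L_2&=\big\{y+2k+3\cdot[0,k]\mid y,k\in\mathbb N_0\big\},\\ \mathcal L_3&=\big\{y+[2,3],\ y+[2,4],\ y+[3,6],\ y+[3,7],\ y+[4,9]\mid y\in\mathbb N_0\big\}\\ &\quad\cup\big\{y+[m,m+k]\mid y\in\mathbb N_0,\ k\ge 6,\ m\in\mathbb N_0\text{ minimal with }m+k\le 5m/2\big\}\\ &=\big\{y+\lceil 2k/3\rceil+[0,k]\mid y\in\mathbb N_0,\ k\in\mathbb N\setminus\{1,3\}\big\}\cup\big\{y+3+[0,3],\ y+2+[0,1]\mid y\in\mathbb N_0\big\},\\ \mathcal L_4&=\big\{y+2k+2\cdot[0,k]\mid y,k\in\mathbb N_0\big\},\\ \mathcal L_5&=\big\{y+k+2+([0,k]\cup\{k+2\})\mid y\in\mathbb N_0,\ k\in\mathbb N\big\},\\ \mathcal L_6&=\big\{y+2\lceil k/3\rceil+2+(\{0\}\cup[2,k+2])\mid y\in\mathbb N_0,\ k\ge 5\text{ or }k=3\big\},\\ \mathcal L_7&=\big\{y+2k+3+\{0,1,3\}+3\cdot[0,k]\mid y,k\in\mathbb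 N_0\big\}\\ &\quad\cup\big\{(y+2k+4+\{0,1,3\}+3\cdot[0,k])\cup\{y+5k+8\}\mid y,k\in\mathbb N_0\big\},\\ \mathcal L_8&=\big\{y+2k+3+\{0,2,3\}+3\cdot[0,k]\mid y,k\in\mathbb N_0\big\}\\ &\quad\cup\big\{(y+2k+4+\{0,2,3\}+3\cdot[0,k])\cup\{y+5k+9\}\mid y,k\in\mathbb N_0\big\}. \end{align*} In particular, the two descriptions of $\mathcal L_3$ define the same family. -/

import Mathlib

namespace SetsOfLengths

open scoped Pointwise

/-- The set of lengths of an element `a` of a commutative monoid, written additively: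
`{0}` if `a` is invertible, and otherwise the set of all positive `k` such that `a` is a sum
of `k` atoms (irreducible elements). -/
def lengths {H : Type*} [AddCommMonoid H] (a : H) : Set ℕ :=
  {k | (IsAddUnit a ∧ k = 0) ∨
    (¬ IsAddUnit a ∧ 0 < k ∧
      ∃ z : Multiset H, z.card = k ∧ (∀ u ∈ z, AddIrreducible u) ∧ z.sum = a)}

/-- The system of sets of lengths of a commutative monoid, written additively. -/
def lengthSystem (H : Type*) [AddCommMonoid H] : Set (Set ℕ) :=
  Set.range (lengths : H → Set ℕ)

/-- The monoid of zero-sum sequences over an abelian group `G`: finite unordered sequences with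
repetition (multisets) of elements of `G` whose sum is zero, under concatenation. -/
def zeroSumSequences (G : Type*) [AddCommGroup G] : AddSubmonoid (Multiset G) where
  carrier := {S | S.sum = 0}
  add_mem' := by
    intro a b ha hb
    change (a + b).sum = 0
    rw [Multiset.sum_add, show a.sum = 0 from ha, show b.sum = 0 from hb, add_zero]
  zero_mem' := Multiset.sum_zero

/-- The dilation `d · L = {d * x | x ∈ L}`. -/
def dilate (d : ℕ) (L : Set ℕ) : Set ℕ := (fun x => d * x) '' L

/-! Below, `+` between sets of natural numbers is the sumset (Minkowski sum), so that
`{y} + L` is the shift of `L` by `y`. -/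

/-- Singletons. -/
def family1 : Set (Set ℕ) := {L | ∃ y : ℕ, L = {y}}

/-- Arithmetical progressions with difference `3`. -/
def family2 : Set (Set ℕ) :=
  {L | ∃ y k : ℕ, L = {y + 2 * k} + dilate 3 (Set.Icc 0 k)}

/-- Intervals, described by five exceptional shapes and an extremality condition. -/
def family3 : Set (Set ℕ) :=
  {L | ∃ y : ℕ, L = {y} + Set.Icc 2 3 ∨ L = {y} + Set.Icc 2 4 ∨ L = {y} + Set.Icc 3 6 ∨
    L = {y} + Set.Icc 3 7 ∨ L = {y} + Set.Icc 4 9} ∪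
  {L | ∃ y k m : ℕ, 6 ≤ k ∧ IsLeast {n : ℕ | (n : ℚ) + k ≤ 5 * n / 2} m ∧
    L = {y} + Set.Icc m (m + k)}

/-- Intervals, described by a closed formula for the minimum. -/
def family3' : Set (Set ℕ) :=
  {L | ∃ y k : ℕ, 1 ≤ k ∧ k ≠ 1 ∧ k ≠ 3 ∧
    L = {y + ⌈(2 * k : ℚ) / 3⌉₊} + Set.Icc 0 k} ∪
  {L | ∃ y : ℕ, L = {y + 3} + Set.Icc 0 3 ∨ L = {y + 2} + Set.Icc 0 1}

/-- Arithmetical progressions with difference `2`. -/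
def family4 : Set (Set ℕ) :=
  {L | ∃ y k : ℕ, L = {y + 2 * k} + dilate 2 (Set.Icc 0 k)}

/-- Intervals with a gap before the maximum. -/
def family5 : Set (Set ℕ) :=
  {L | ∃ y k : ℕ, 1 ≤ k ∧ L = {y + k + 2} + (Set.Icc 0 k ∪ {k + 2})}

/-- Intervals with a gap after the minimum. -/
def family6 : Set (Set ℕ) :=
  {L | ∃ y k : ℕ, (5 ≤ k ∨ k = 3) ∧
    L = {y + 2 * ⌈(k : ℚ) / 3⌉₊ + 2} + ({0} ∪ Set.Icc 2 (k + 2))}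

/-- Multiprogressions with period `{0, 1, 3}`. -/
def family7 : Set (Set ℕ) :=
  {L | ∃ y k : ℕ, L = {y + 2 * k + 3} + {0, 1, 3} + dilate 3 (Set.Icc 0 k)} ∪
  {L | ∃ y k : ℕ, L = ({y + 2 * k + 4} + {0, 1, 3} + dilate 3 (Set.Icc 0 k)) ∪ {y + 5 * k + 8}}

/-- Multiprogressions with period `{0, 2, 3}`. -/
def family8 : Set (Set ℕ) :=
  {L | ∃ y k : ℕ, L = {y + 2 * k + 3} + {0, 2, 3} + dilate 3 (Set.Icc 0 k)} ∪
  {L | ∃ y k : ℕ, L = ({y + 2 * k + 4} + {0, 2, 3} + dilate 3 (Set.Icc 0 k)) ∪ {y + 5 * k + 9}}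

end SetsOfLengths

/-!
Over an elementary abelian `2`-group the irreducible zero-sum sequences other than the one-term
sequence `0` are the squares `g ^ 2` and the circuits, the minimal nonempty sets without `0` that
sum to zero. Let the weight of a factorization be the sum of `|C| - 2` over its circuits `C`. If `0`
does not occur in `A`, a factorization of `A` of length `k` has weight `|A| - 2 * k`, so the set of
lengths is an affine image of the set of weights.

In rank `4` a circuit has at most five elements. Exchanging the circuits of a factorization for
others lowers its weight by exactly two, unless the weight is already minimal, or `A` is supported
on a theta (a circuit of five elements and a chord that splits it into two and three), or `A` is the
square of a sequence whose circuits all have four elements. Apart from these exceptions the sets of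
lengths are intervals. On a theta the weights are determined by the least multiplicities on the two
parts and on the chord, and running through the shapes of these three numbers gives the families.
Conversely, every set in the families comes from a theta, from two circuits of five elements, or
from three parallel pairs.
-/

namespace SetsOfLengths

open scoped symmDiff

section Circuits

variable {G : Type*}

theorem count_val [DecidableEq G] (X : Finset G) (x : G) :
    X.val.count x = if x ∈ X then 1 else 0 :=
  Multiset.count_eq_of_nodup X.nodup

theorem val_add_val [DecidableEq G] (X Y : Finset G) :
    X.val + Y.val = (X ∆ Y).val + 2 • (X ∩ Y).val := by
  ext x
  simp only [Multiset.count_add, Multiset.count_nsmul, count_val, Finset.mem_symmDiff,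
    Finset.mem_inter]
  grind

theorem card_symmDiff_add [DecidableEq G] (X Y : Finset G) :
    (X ∆ Y).card + 2 * (X ∩ Y).card = X.card + Y.card := by
  simpa [-Finset.inter_val] using congrArg Multiset.card (val_add_val X Y).symm

variable [AddCommGroup G]

/-- A finite set of nonzero elements with sum zero. In exponent `2` these are the cycles of the
binary matroid on the nonzero elements of `G`. -/
structure IsCycle (X : Finset G) : Prop where
  zero_notMem : 0 ∉ X
  sum_eq_zero : ∑ x ∈ X, x = 0

/-- A circuit: a minimal nonempty cycle. The squarefree atoms of the monoid of zero-sum sequences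
are the circuits and the one-term sequence `0`. -/
def IsCircuit (C : Finset G) : Prop :=
  Minimal (fun X => X.Nonempty ∧ IsCycle X) C

namespace IsCircuit

variable {C Y : Finset G}

theorem isCycle (hC : IsCircuit C) : IsCycle C := hC.prop.2

theorem nonempty (hC : IsCircuit C) : C.Nonempty := hC.prop.1

theorem eq_of_subset (hC : IsCircuit C) (hY : IsCycle Y) (hne : Y.Nonempty) (h : Y ⊆ C) : Y = C :=
  h.antisymm (hC.le_of_le ⟨hne, hY⟩ h)

end IsCircuit

theorem IsCycle.mono_sum {X Y : Finset G} (hX : IsCycle X) (h : Y ⊆ X) (hs : ∑ x ∈ Y, x = 0) :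
    IsCycle Y :=
  ⟨fun h0 => hX.zero_notMem (h h0), hs⟩

theorem IsCycle.exists_isCircuit_subset {X : Finset G} (hX : IsCycle X) (hne : X.Nonempty) :
    ∃ C ⊆ X, IsCircuit C := by
  obtain ⟨C, hCX, hC⟩ := Set.Finite.exists_le_minimal
    (s := {Y | Y ⊆ X ∧ Y.Nonempty ∧ IsCycle Y})
    (X.powerset.finite_toSet.subset fun Y hY => by simpa using hY.1) ⟨subset_rfl, hne, hX⟩
  refine ⟨C, hCX, hC.prop.2, fun Y hY hYC => hC.le_of_le ⟨hYC.trans hCX, hY⟩ hYC⟩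

variable [Module (ZMod 2) G]

theorem sum_symmDiff [DecidableEq G] (X Y : Finset G) :
    ∑ x ∈ X ∆ Y, x = ∑ x ∈ X, x + ∑ x ∈ Y, x := by
  have hs := congrArg Multiset.sum (val_add_val X Y)
  simpa [Multiset.sum_nsmul, two_nsmul, ZModModule.add_self] using hs.symm

namespace IsCycle

variable {X Y : Finset G}

theorem symmDiff [DecidableEq G] (hX : IsCycle X) (hY : IsCycle Y) : IsCycle (X ∆ Y) where
  zero_notMem h := by
    rcases Finset.mem_symmDiff.1 h with h | h
    exacts [hX.zero_notMem h.1, hY.zero_notMem h.1]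
  sum_eq_zero := by rw [sum_symmDiff, hX.sum_eq_zero, hY.sum_eq_zero, add_zero]

theorem sdiff [DecidableEq G] (hX : IsCycle X) (hY : IsCycle Y) (h : Y ⊆ X) : IsCycle (X \ Y) := by
  rw [← symmDiff_of_ge h]
  exact hX.symmDiff hY

theorem three_le_card (hX : IsCycle X) (hne : X.Nonempty) : 3 ≤ X.card := by
  classical
  by_contra hlt
  obtain h | h : X.card = 1 ∨ X.card = 2 := by have := hne.card_pos; omega
  · obtain ⟨a, rfl⟩ := Finset.card_eq_one.1 h
    exact hX.zero_notMem (by simpa [eq_comm] using hX.sum_eq_zero)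
  · obtain ⟨a, b, hab, rfl⟩ := Finset.card_eq_two.1 h
    have hs : a + b = 0 := by simpa [Finset.sum_pair hab] using hX.sum_eq_zero
    exact hab (by rwa [← ZModModule.sub_eq_add, sub_eq_zero] at hs)

theorem isCircuit (hX : IsCycle X) (hne : X.Nonempty) (h5 : X.card ≤ 5) : IsCircuit X := by
  classical
  refine ⟨⟨hne, hX⟩, fun Y hY hYX => Finset.sdiff_eq_empty_iff_subset.1 ?_⟩
  by_contra h
  have hc := Finset.card_sdiff_add_card_eq_card hYX
  have := hY.2.three_le_card hY.1
  have := (hX.sdiff hY.2 hYX).three_le_card (Finset.nonempty_iff_ne_empty.2 h)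
  omega

end IsCycle

theorem exists_isCycle_subset [Fintype G] {X : Finset G} (h0 : 0 ∉ X)
    (hX : Fintype.card G < 2 ^ X.card) : ∃ Y ⊆ X, Y.Nonempty ∧ IsCycle Y := by
  classical
  obtain ⟨Y, hY, Z, hZ, hne, hYZ⟩ := Finset.exists_ne_map_eq_of_card_lt_of_maps_to
    (s := X.powerset) (t := Finset.univ) (f := fun Y => ∑ x ∈ Y, x)
    (by rwa [Finset.card_univ, Finset.card_powerset]) fun _ _ => Finset.mem_univ _
  rw [Finset.mem_powerset] at hY hZ
  have hsub : Y ∆ Z ⊆ X := Finset.symmDiff_subset_union.trans (Finset.union_subset hY hZ)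
  refine ⟨Y ∆ Z, hsub, Finset.symmDiff_nonempty.2 hne, fun h => h0 (hsub h), ?_⟩
  rw [sum_symmDiff, hYZ, ZModModule.add_self]

end Circuits

/-- The elementary abelian `2`-group of rank `4`. -/
abbrev E4 := Fin 4 → ZMod 2

theorem exists_isCycle_of_five_le_card {X : Finset E4} (h0 : 0 ∉ X) (hX : 5 ≤ X.card) :
    ∃ Y ⊆ X, Y.Nonempty ∧ IsCycle Y := by
  refine exists_isCycle_subset h0 ?_
  calc Fintype.card E4 = 2 ^ 4 := by simp [E4]
    _ < 2 ^ X.card := Nat.pow_lt_pow_right one_lt_two hX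

theorem IsCircuit.card_le_five {C : Finset E4} (hC : IsCircuit C) : C.card ≤ 5 := by
  by_contra! h
  obtain ⟨e, he⟩ := hC.nonempty
  obtain ⟨Y, hYC, hne, hY⟩ := exists_isCycle_of_five_le_card (X := C.erase e)
    (fun h0 => hC.isCycle.zero_notMem (Finset.mem_of_mem_erase h0))
    (by rw [Finset.card_erase_of_mem he]; omega)
  have := hC.eq_of_subset hY hne (hYC.trans (Finset.erase_subset e C))
  exact Finset.notMem_erase e C (hYC (this ▸ he))

section Weight

variable {G : Type*}

/-- The sequence obtained by concatenating the sets of a family. -/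
def cover (F : Multiset (Finset G)) : Multiset G := (F.map Finset.val).sum

/-- The sum of `|C| - 2` over a family of sets. A factorization of `A` into the circuits of `F` and
squares of elements has `k` factors, where `2 * k + weight F = |A|`. -/
def weight (F : Multiset (Finset G)) : ℕ := (F.map fun C => C.card - 2).sum

@[simp] theorem cover_zero : cover (0 : Multiset (Finset G)) = 0 := rfl

@[simp] theorem cover_singleton (C : Finset G) : cover {C} = C.val := by
  simp only [cover, Multiset.map_singleton, Multiset.sum_singleton]

@[simp] theorem cover_cons (C : Finset G) (F : Multiset (Finset G)) :
    cover (C ::ₘ F) = C.val + cover F := by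
  simp only [cover, Multiset.map_cons, Multiset.sum_cons]

@[simp] theorem cover_add (F F' : Multiset (Finset G)) :
    cover (F + F') = cover F + cover F' := by
  simp only [cover, Multiset.map_add, Multiset.sum_add]

@[simp] theorem cover_replicate (n : ℕ) (C : Finset G) :
    cover (Multiset.replicate n C) = n • C.val := by
  simp only [cover, Multiset.map_replicate, Multiset.sum_replicate]

@[simp] theorem weight_zero : weight (0 : Multiset (Finset G)) = 0 := rfl

@[simp] theorem weight_singleton (C : Finset G) : weight {C} = C.card - 2 := by
  simp only [weight, Multiset.map_singleton, Multiset.sum_singleton]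

@[simp] theorem weight_cons (C : Finset G) (F : Multiset (Finset G)) :
    weight (C ::ₘ F) = C.card - 2 + weight F := by
  simp only [weight, Multiset.map_cons, Multiset.sum_cons]

@[simp] theorem weight_add (F F' : Multiset (Finset G)) :
    weight (F + F') = weight F + weight F' := by
  simp only [weight, Multiset.map_add, Multiset.sum_add]

@[simp] theorem weight_replicate (n : ℕ) (C : Finset G) :
    weight (Multiset.replicate n C) = n * (C.card - 2) := by
  simp only [weight, Multiset.map_replicate, Multiset.sum_replicate, smul_eq_mul]

theorem mem_cover {F : Multiset (Finset G)} {x : G} : x ∈ cover F ↔ ∃ C ∈ F, x ∈ C := by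
  induction F using Multiset.induction_on with
  | empty => simp
  | cons C F ih => simp [ih]

theorem weight_le_mul_card {F : Multiset (Finset G)} {c : ℕ} (hF : ∀ C ∈ F, C.card ≤ c + 2) :
    weight F ≤ c * F.card := by
  induction F using Multiset.induction_on with
  | empty => simp
  | cons C F ih =>
    obtain ⟨hC, hF⟩ := Multiset.forall_mem_cons.1 hF
    have := ih hF
    rw [weight_cons, Multiset.card_cons, mul_add, mul_one]
    omega

theorem exists_add_two_nsmul_eq [DecidableEq G] {A B : Multiset G}
    (h : ∀ x, A.count x ≤ B.count x ∧ A.count x % 2 = B.count x % 2) : ∃ R, A + 2 • R = B := by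
  obtain ⟨R, hR⟩ := Multiset.exists_smul_of_dvd_count (B - A) (k := 2) fun x _ => by
    rw [Multiset.count_sub]
    have := h x
    omega
  exact ⟨R, by rw [← hR, add_tsub_cancel_of_le (Multiset.le_iff_count.2 fun x => (h x).1)]⟩

variable [AddCommGroup G]

/-- `A` is a concatenation of circuits and squares of elements, with circuits of weight `w`. -/
def HasWeight (A : Multiset G) (w : ℕ) : Prop :=
  ∃ F : Multiset (Finset G), (∀ C ∈ F, IsCircuit C) ∧ (∃ R, cover F + 2 • R = A) ∧ weight F = w

theorem IsCircuit.hasWeight {C : Finset G} (hC : IsCircuit C) : HasWeight C.val (C.card - 2) :=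
  ⟨{C}, by simpa using hC, ⟨0, by simp⟩, by simp⟩

theorem hasWeight_two_nsmul (R : Multiset G) : HasWeight (2 • R) 0 :=
  ⟨0, by simp, ⟨R, by simp⟩, rfl⟩

namespace HasWeight

variable {A B : Multiset G} {v w : ℕ}

theorem add (hA : HasWeight A v) (hB : HasWeight B w) : HasWeight (A + B) (v + w) := by
  obtain ⟨F, hF, ⟨R, rfl⟩, rfl⟩ := hA
  obtain ⟨F', hF', ⟨R', rfl⟩, rfl⟩ := hB
  refine ⟨F + F', fun C hC => (Multiset.mem_add.1 hC).elim (hF C) (hF' C), ⟨R + R', ?_⟩,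
    weight_add F F'⟩
  rw [cover_add, nsmul_add]
  abel

theorem nsmul (hA : HasWeight A w) (n : ℕ) : HasWeight (n • A) (n * w) := by
  induction n with
  | zero => simpa using hasWeight_two_nsmul (0 : Multiset G)
  | succ n ih => simpa only [succ_nsmul, add_mul, one_mul] using ih.add hA

theorem add_two_nsmul (hA : HasWeight A w) (R : Multiset G) : HasWeight (A + 2 • R) w :=
  hA.add (hasWeight_two_nsmul R)

theorem mono [DecidableEq G] (hA : HasWeight A w)
    (h : ∀ x, A.count x ≤ B.count x ∧ A.count x % 2 = B.count x % 2) : HasWeight B w := by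
  obtain ⟨R, rfl⟩ := exists_add_two_nsmul_eq h
  exact hA.add_two_nsmul R

end HasWeight

theorem sum_cover {F : Multiset (Finset G)} (hF : ∀ C ∈ F, IsCircuit C) : (cover F).sum = 0 := by
  induction F using Multiset.induction_on with
  | empty => rfl
  | cons C F ih =>
    obtain ⟨hC, hF⟩ := Multiset.forall_mem_cons.1 hF
    have hs : C.val.sum = 0 := by simpa using hC.isCycle.sum_eq_zero
    rw [cover_cons, Multiset.sum_add, ih hF, hs, add_zero]

variable [Module (ZMod 2) G]

theorem IsCircuit.three_le_card {C : Finset G} (hC : IsCircuit C) : 3 ≤ C.card :=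
  hC.isCycle.three_le_card hC.nonempty

theorem card_cover {F : Multiset (Finset G)} (hF : ∀ C ∈ F, IsCircuit C) :
    (cover F).card = weight F + 2 * F.card := by
  induction F using Multiset.induction_on with
  | empty => rfl
  | cons C F ih =>
    obtain ⟨hC, hF⟩ := Multiset.forall_mem_cons.1 hF
    have := hC.three_le_card
    rw [cover_cons, weight_cons, Multiset.card_add, Multiset.card_cons, Finset.card_val, ih hF]
    omega

theorem card_le_weight {F : Multiset (Finset G)} (hF : ∀ C ∈ F, IsCircuit C) :
    F.card ≤ weight F := by
  induction F using Multiset.induction_on with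
  | empty => rfl
  | cons C F ih =>
    obtain ⟨hC, hF⟩ := Multiset.forall_mem_cons.1 hF
    have := hC.three_le_card
    have := ih hF
    rw [weight_cons, Multiset.card_cons]
    omega

namespace HasWeight

variable {A : Multiset G} {w : ℕ}

theorem card_eq (hA : HasWeight A w) : ∃ n, A.card = w + 2 * n := by
  obtain ⟨F, hF, ⟨R, rfl⟩, rfl⟩ := hA
  exact ⟨F.card + R.card, by rw [Multiset.card_add, card_cover hF, Multiset.card_nsmul]; ring⟩

theorem le_card (hA : HasWeight A w) : w ≤ A.card := by
  obtain ⟨n, hn⟩ := hA.card_eq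
  omega

theorem mod_two (hA : HasWeight A w) : w % 2 = A.card % 2 := by
  obtain ⟨n, hn⟩ := hA.card_eq
  omega

theorem sum_eq_zero (hA : HasWeight A w) : A.sum = 0 := by
  obtain ⟨F, hF, ⟨R, rfl⟩, -⟩ := hA
  rw [Multiset.sum_add, Multiset.sum_nsmul, sum_cover hF, two_nsmul, ZModModule.add_self, add_zero]

theorem exists_eq_two_nsmul (hA : HasWeight A 0) : ∃ R, A = 2 • R := by
  obtain ⟨F, hF, ⟨R, rfl⟩, hw⟩ := hA
  have h0 : F = 0 := Multiset.card_eq_zero.1 (by have := card_le_weight hF; omega)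
  exact ⟨R, by rw [h0, cover_zero, zero_add]⟩

end HasWeight

theorem IsCycle.exists_cover_eq {X : Finset G} (hX : IsCycle X) :
    ∃ F, (∀ C ∈ F, IsCircuit C) ∧ cover F = X.val := by
  classical
  induction X using Finset.strongInduction with
  | H X ih =>
    obtain rfl | hne := X.eq_empty_or_nonempty
    · exact ⟨0, by simp, rfl⟩
    obtain ⟨C, hCX, hC⟩ := hX.exists_isCircuit_subset hne
    obtain ⟨F, hF, hFX⟩ :=
      ih (X \ C) (Finset.sdiff_ssubset hCX hC.nonempty) (hX.sdiff hC.isCycle hCX)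
    refine ⟨C ::ₘ F, Multiset.forall_mem_cons.2 ⟨hC, hF⟩, ?_⟩
    rw [cover_cons, hFX, Finset.sdiff_val, add_tsub_cancel_of_le (Finset.val_le_iff.2 hCX)]

theorem exists_hasWeight {A : Multiset G} (h0 : 0 ∉ A) (hs : A.sum = 0) : ∃ w, HasWeight A w := by
  classical
  set X := A.toFinset.filter fun x => Odd (A.count x) with hX
  have hcount : ∀ x, X.val.count x ≤ A.count x ∧ X.val.count x % 2 = A.count x % 2 := fun x => by
    have hx : x ∈ X ↔ 0 < A.count x ∧ A.count x % 2 = 1 := by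
      rw [hX, Finset.mem_filter, Multiset.mem_toFinset, Multiset.count_pos, Nat.odd_iff]
    rw [count_val]
    split_ifs with h <;> rw [hx] at h <;> omega
  obtain ⟨R, hA⟩ := exists_add_two_nsmul_eq hcount
  have hXs : IsCycle X := by
    refine ⟨fun h => h0 (by simp_all), ?_⟩
    rw [← hA, Multiset.sum_add, Multiset.sum_nsmul, two_nsmul, ZModModule.add_self, add_zero] at hs
    simpa using hs
  obtain ⟨F, hF, hFX⟩ := hXs.exists_cover_eq
  exact ⟨_, F, hF, ⟨R, by rw [hFX, hA]⟩, rfl⟩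

end Weight

theorem weight_le_three_mul_card {F : Multiset (Finset E4)} (hF : ∀ C ∈ F, IsCircuit C) :
    weight F ≤ 3 * F.card :=
  weight_le_mul_card fun C hC => (hF C hC).card_le_five

theorem HasWeight.five_mul_le {A : Multiset E4} {w : ℕ} (hA : HasWeight A w) :
    5 * w ≤ 3 * A.card := by
  obtain ⟨F, hF, ⟨R, rfl⟩, rfl⟩ := hA
  have := weight_le_three_mul_card hF
  rw [Multiset.card_add, card_cover hF]
  omega

theorem IsCycle.hasWeight_of_card_le_eight {X : Finset E4} (hX : IsCycle X) (h6 : 6 ≤ X.card)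
    (h8 : X.card ≤ 8) : HasWeight X.val (X.card - 4) := by
  obtain ⟨F, hF, hFX⟩ := hX.exists_cover_eq
  have hc := card_cover hF
  have := weight_le_three_mul_card hF
  have := card_le_weight hF
  rw [hFX, Finset.card_val] at hc
  have h2 : F.card = 2 := by omega
  exact ⟨F, hF, ⟨0, by simp [hFX]⟩, by omega⟩

section Lengths

variable {G : Type*} [AddCommGroup G]

theorem isAddUnit_zeroSumSequences_iff {u : zeroSumSequences G} : IsAddUnit u ↔ u.1 = 0 := by
  constructor
  · intro h
    obtain ⟨v, hv⟩ := isAddUnit_iff_exists_neg.1 h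
    exact (add_eq_zero.1 (congrArg Subtype.val hv : u.1 + v.1 = 0)).1
  · intro h
    rw [show u = 0 from Subtype.ext h]
    exact isAddUnit_zero

theorem addIrreducible_iff_minimal {u : zeroSumSequences G} :
    AddIrreducible u ↔ u.1 ≠ 0 ∧ ∀ B ≤ u.1, B.sum = 0 → B = 0 ∨ B = u.1 := by
  rw [addIrreducible_iff, isAddUnit_zeroSumSequences_iff]
  refine and_congr_right' ⟨fun h B hB hs => ?_, fun h a b hab => ?_⟩
  · obtain ⟨D, hD⟩ := Multiset.le_iff_exists_add.1 hB
    have hDs : D.sum = 0 := by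
      have hu : u.1.sum = 0 := u.2
      rwa [hD, Multiset.sum_add, hs, zero_add] at hu
    refine (h (a := ⟨B, hs⟩) (b := ⟨D, hDs⟩) (Subtype.ext hD)).imp
      isAddUnit_zeroSumSequences_iff.1 fun hu => ?_
    rw [hD, show D = 0 from isAddUnit_zeroSumSequences_iff.1 hu, add_zero]
  · have hab' : u.1 = a.1 + b.1 := congrArg Subtype.val hab
    simp only [isAddUnit_zeroSumSequences_iff]
    refine (h a.1 (hab' ▸ Multiset.le_add_right _ _) a.2).imp_right fun ha => ?_
    rwa [← ha, left_eq_add] at hab'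

theorem IsCircuit.addIrreducible {u : zeroSumSequences G} {C : Finset G} (hC : IsCircuit C)
    (hu : u.1 = C.val) : AddIrreducible u := by
  refine addIrreducible_iff_minimal.2 ⟨fun h => ?_, fun B hB hs => ?_⟩
  · exact hC.nonempty.ne_empty (Finset.val_eq_zero.1 (hu ▸ h))
  rw [hu] at hB ⊢
  set Y : Finset G := ⟨B, Multiset.nodup_of_le hB C.nodup⟩
  have hYC : Y ⊆ C := Finset.val_le_iff.1 hB
  obtain hY | hY := Y.eq_empty_or_nonempty
  · exact .inl (congrArg Finset.val hY)
  · have hYs : ∑ x ∈ Y, x = 0 := (Finset.sum_val Y).symm.trans hs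
    exact .inr (congrArg Finset.val (hC.eq_of_subset (hC.isCycle.mono_sum hYC hYs) hY hYC))

theorem addIrreducible_of_eq_two_nsmul {u : zeroSumSequences G} {g : G} (hg : g ≠ 0)
    (hu : u.1 = 2 • {g}) : AddIrreducible u := by
  rw [addIrreducible_iff_minimal, hu, Multiset.nsmul_singleton]
  refine ⟨by simp, fun B hB hs => ?_⟩
  obtain ⟨n, hn, rfl⟩ := Multiset.le_replicate_iff.1 hB
  interval_cases n
  · exact .inl rfl
  · exact absurd (by simpa using hs) hg
  · exact .inr rfl

theorem addIrreducible_of_eq_singleton {u : zeroSumSequences G} (hu : u.1 = {0}) :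
    AddIrreducible u := by
  rw [addIrreducible_iff_minimal, hu]
  exact ⟨by simp, fun B hB _ => Multiset.le_singleton.1 hB⟩

theorem addIrreducible_cases [Module (ZMod 2) G] {u : zeroSumSequences G} (hu : AddIrreducible u) :
    u.1 = {0} ∨ (∃ g ≠ 0, u.1 = 2 • {g}) ∨ ∃ C, IsCircuit C ∧ u.1 = C.val := by
  obtain ⟨hne, hmin⟩ := addIrreducible_iff_minimal.1 hu
  by_cases h0 : (0 : G) ∈ u.1
  · exact .inl ((hmin {0} (Multiset.singleton_le.2 h0) (by simp)).resolve_left (by simp)).symm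
  by_cases hnd : u.1.Nodup
  · refine .inr (.inr ⟨⟨u.1, hnd⟩, ⟨⟨?_, h0, (Finset.sum_val _).symm.trans u.2⟩, ?_⟩, rfl⟩)
    · exact Finset.nonempty_iff_ne_empty.2 fun h => hne (congrArg Finset.val h)
    · intro Y hY hYC
      have hYu := hmin Y.val (Finset.val_le_iff.2 hYC) ((Finset.sum_val Y).trans hY.2.sum_eq_zero)
      exact Finset.val_le_iff.1 (hYu.resolve_left fun h =>
        hY.1.ne_empty (Finset.val_eq_zero.1 h)).ge
  · obtain ⟨g, hg⟩ : ∃ g, 2 • {g} ≤ u.1 := by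
      simpa [Multiset.nodup_iff_le, two_nsmul] using hnd
    refine .inr (.inl ⟨g, ?_, ((hmin _ hg ?_).resolve_left (by simp [two_nsmul])).symm⟩)
    · rintro rfl
      exact h0 (Multiset.mem_of_le hg (by simp [two_nsmul]))
    · rw [Multiset.sum_nsmul, Multiset.sum_singleton, two_nsmul, ZModModule.add_self]

/-- The sequence `A` is a concatenation of `k` atoms of the monoid of zero-sum sequences. -/
def HasFactorization (A : Multiset G) (k : ℕ) : Prop :=
  ∃ z : Multiset (zeroSumSequences G), z.card = k ∧ (∀ u ∈ z, AddIrreducible u) ∧ z.sum.1 = A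

theorem mem_lengths_iff {a : zeroSumSequences G} {k : ℕ} :
    k ∈ lengths a ↔ HasFactorization a.1 k := by
  have eq_zero {z : Multiset (zeroSumSequences G)} (hz : ∀ u ∈ z, AddIrreducible u)
      (hu : IsAddUnit z.sum) : z = 0 := by
    refine Multiset.eq_zero_of_forall_notMem fun u huz => (hz u huz).not_isAddUnit ?_
    obtain ⟨t, rfl⟩ := Multiset.exists_cons_of_mem huz
    rw [Multiset.sum_cons] at hu
    exact isAddUnit_of_add_isAddUnit_left hu
  constructor
  · rintro (⟨ha, rfl⟩ | ⟨-, -, z, hk, hz, rfl⟩)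
    · exact ⟨0, rfl, by simp, (isAddUnit_zeroSumSequences_iff.1 ha).symm⟩
    · exact ⟨z, hk, hz, rfl⟩
  · rintro ⟨z, rfl, hz, hs⟩
    obtain rfl : z.sum = a := Subtype.ext hs
    by_cases ha : IsAddUnit z.sum
    · exact .inl ⟨ha, by rw [eq_zero hz ha, Multiset.card_zero]⟩
    · refine .inr ⟨ha, Multiset.card_pos.2 ?_, z, rfl, hz, rfl⟩
      rintro rfl
      exact ha isAddUnit_zero

namespace HasFactorization

variable {A B : Multiset G} {k l : ℕ}

theorem add (hA : HasFactorization A k) (hB : HasFactorization B l) :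
    HasFactorization (A + B) (k + l) := by
  obtain ⟨z, rfl, hz, rfl⟩ := hA
  obtain ⟨z', rfl, hz', rfl⟩ := hB
  exact ⟨z + z', Multiset.card_add _ _,
    fun u hu => (Multiset.mem_add.1 hu).elim (hz u) (hz' u), by rw [Multiset.sum_add]; rfl⟩

end HasFactorization

theorem hasFactorization_zero : HasFactorization (0 : Multiset G) 0 :=
  ⟨0, by simp, by simp, rfl⟩

theorem hasFactorization_one {u : zeroSumSequences G} (hu : AddIrreducible u) :
    HasFactorization u.1 1 :=
  ⟨{u}, by simp, by simpa using hu, by simp⟩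

theorem hasFactorization_cover {F : Multiset (Finset G)} (hF : ∀ C ∈ F, IsCircuit C) :
    HasFactorization (cover F) F.card := by
  induction F using Multiset.induction_on with
  | empty => exact hasFactorization_zero
  | cons C F ih =>
    obtain ⟨hC, hF⟩ := Multiset.forall_mem_cons.1 hF
    have hCs : C.val.sum = 0 := (Finset.sum_val C).trans hC.isCycle.sum_eq_zero
    rw [cover_cons, Multiset.card_cons, add_comm _ 1]
    exact (hasFactorization_one (u := ⟨C.val, hCs⟩) (hC.addIrreducible rfl)).add (ih hF)

theorem hasFactorization_replicate_zero (j : ℕ) :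
    HasFactorization (Multiset.replicate j (0 : G)) j := by
  induction j with
  | zero => exact hasFactorization_zero
  | succ j ih =>
    rw [Multiset.replicate_add]
    exact ih.add (hasFactorization_one (u := ⟨{0}, by simp [zeroSumSequences]⟩)
      (addIrreducible_of_eq_singleton rfl))

variable [Module (ZMod 2) G]

theorem hasFactorization_two_nsmul {R : Multiset G} (h0 : 0 ∉ R) :
    HasFactorization (2 • R) R.card := by
  induction R using Multiset.induction_on with
  | empty => exact hasFactorization_zero
  | cons g R ih =>
    rw [Multiset.mem_cons, not_or] at h0
    have hg : (2 • {g} : Multiset G).sum = 0 := by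
      rw [Multiset.sum_nsmul, two_nsmul, ZModModule.add_self]
    rw [← Multiset.singleton_add, nsmul_add, Multiset.card_add, Multiset.card_singleton]
    exact (hasFactorization_one (u := ⟨2 • {g}, hg⟩)
      (addIrreducible_of_eq_two_nsmul (Ne.symm h0.1) rfl)).add (ih h0.2)

theorem HasFactorization.exists_hasWeight [DecidableEq G] {A : Multiset G} {k : ℕ}
    (hA : HasFactorization A k) :
    ∃ w, HasWeight (A.filter (· ≠ 0)) w ∧
      2 * k + w = (A.filter (· ≠ 0)).card + 2 * A.count 0 := by
  obtain ⟨z, rfl, hz, rfl⟩ := hA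
  induction z using Multiset.induction_on with
  | empty => exact ⟨0, by simpa using hasWeight_two_nsmul (0 : Multiset G), rfl⟩
  | cons u z ih =>
    obtain ⟨hu, hz⟩ := Multiset.forall_mem_cons.1 hz
    obtain ⟨w, hw, hk⟩ := ih hz
    have hs : (u ::ₘ z).sum.1 = u.1 + z.sum.1 := by rw [Multiset.sum_cons]; rfl
    rw [hs, Multiset.filter_add, Multiset.card_add, Multiset.count_add, Multiset.card_cons]
    generalize z.sum.1 = S at hw hk ⊢
    obtain h | ⟨g, hg, h⟩ | ⟨C, hC, h⟩ := addIrreducible_cases hu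
    · have hf : Multiset.filter (· ≠ 0) {(0 : G)} = 0 := by simp
      refine ⟨w, by rwa [h, hf, zero_add], ?_⟩
      rw [h, hf, Multiset.count_singleton_self, Multiset.card_zero]
      omega
    · have hf : (2 • {g} : Multiset G).filter (· ≠ 0) = 2 • {g} :=
        Multiset.filter_eq_self.2 fun x hx => by simp_all [two_nsmul]
      refine ⟨0 + w, ?_, ?_⟩
      · rw [h, hf]
        exact (hasWeight_two_nsmul _).add hw
      · rw [h, hf, Multiset.count_nsmul, Multiset.count_singleton, if_neg hg.symm,
          Multiset.card_nsmul, Multiset.card_singleton]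
        omega
    · have h0 := hC.isCycle.zero_notMem
      have hf : C.val.filter (· ≠ 0) = C.val :=
        Multiset.filter_eq_self.2 fun x hx => by rintro rfl; exact h0 hx
      have := hC.three_le_card
      refine ⟨C.card - 2 + w, by rw [h, hf]; exact hC.hasWeight.add hw, ?_⟩
      rw [h, hf, count_val, if_neg h0, Finset.card_val]
      omega

theorem HasWeight.hasFactorization {B : Multiset G} {w k y : ℕ} (h0 : 0 ∉ B) (hB : HasWeight B w)
    (hk : 2 * k + w = B.card + 2 * y) : HasFactorization (B + Multiset.replicate y 0) k := by
  obtain ⟨F, hF, ⟨R, rfl⟩, rfl⟩ := hB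
  have hR : 0 ∉ R := fun h => h0 (by simp [two_nsmul, h])
  rw [Multiset.card_add, card_cover hF, Multiset.card_nsmul] at hk
  obtain rfl : k = F.card + R.card + y := by omega
  exact ((hasFactorization_cover hF).add (hasFactorization_two_nsmul hR)).add
    (hasFactorization_replicate_zero y)

/-- The set of lengths belonging to a set `W` of circuit weights: a factorization of a sequence of
length `N`, each zero counted twice, into atoms of total weight `w` has `(N - w) / 2` factors. -/
def lengthSet (W : ℕ → Prop) (N : ℕ) : Set ℕ := {k | ∃ w, W w ∧ 2 * k + w = N}

theorem mem_lengthSystem_iff {L : Set ℕ} :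
    L ∈ lengthSystem (zeroSumSequences G) ↔ ∃ (B : Multiset G) (y : ℕ), 0 ∉ B ∧ B.sum = 0 ∧
      L = lengthSet (HasWeight B) (B.card + 2 * y) := by
  classical
  have key (a : zeroSumSequences G) (B : Multiset G) (y : ℕ) (h0 : 0 ∉ B)
      (ha : a.1 = B + Multiset.replicate y 0) :
      lengths a = lengthSet (HasWeight B) (B.card + 2 * y) := by
    ext k
    have hf : a.1.filter (· ≠ 0) = B := by
      rw [ha, Multiset.filter_add, Multiset.filter_eq_self.2 fun x hx => ne_of_mem_of_not_mem hx h0]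
      simp [Multiset.mem_replicate]
    have hc : a.1.count 0 = y := by simp [ha, Multiset.count_eq_zero_of_notMem h0]
    rw [mem_lengths_iff]
    refine ⟨fun h => ?_, fun ⟨w, hw, hk⟩ => ha ▸ hw.hasFactorization h0 hk⟩
    obtain ⟨w, hw, hk⟩ := h.exists_hasWeight
    rw [hf] at hw hk
    exact ⟨w, hw, by rw [hk, hc]⟩
  constructor
  · rintro ⟨a, rfl⟩
    have ha : a.1 = a.1.filter (· ≠ 0) + Multiset.replicate (a.1.count 0) 0 := by
      rw [← Multiset.filter_eq', add_comm]
      exact (Multiset.filter_add_not (· = 0) a.1).symm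
    refine ⟨_, _, by simp, ?_, key a _ _ (by simp) ha⟩
    have has : a.1.sum = 0 := a.2
    rw [ha] at has
    simpa using has
  · rintro ⟨B, y, h0, hs, rfl⟩
    exact ⟨⟨B + Multiset.replicate y 0, by simp [zeroSumSequences, hs]⟩, key _ B y h0 rfl⟩

end Lengths

/-- The sequence with multiplicity `p` on `P`, `q` on `Q` and `r` at `g`. -/
def thetaSeq {G : Type*} (P Q : Finset G) (g : G) (p q r : ℕ) : Multiset G :=
  p • P.val + q • Q.val + r • {g}

/-- The weights of a zero-sum sequence supported on a theta, in terms of the least multiplicities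
`x`, `y`, `z` on its three arms: `p` and `q` are the parts of these multiplicities on the first two
arms that are consumed by circuits. -/
def ThetaWeight (x y z w : ℕ) : Prop :=
  ∃ p q, p ≤ x ∧ p % 2 = x % 2 ∧ q ≤ y ∧ q % 2 = y % 2 ∧ p ≤ q + z ∧ q ≤ p + z ∧ w = p + 2 * q

theorem count_thetaSeq {G : Type*} [DecidableEq G] (P Q : Finset G) (g : G) (p q r : ℕ) (x : G) :
    (thetaSeq P Q g p q r).count x =
      (if x ∈ P then p else 0) + (if x ∈ Q then q else 0) + (if x = g then r else 0) := by
  simp only [thetaSeq, Multiset.count_add, Multiset.count_nsmul, count_val,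
    Multiset.count_singleton, mul_ite, mul_one, mul_zero]

theorem exists_forall_le_count_iff {G : Type*} [DecidableEq G] {A : Multiset G} {S : Finset G}
    (hS : S.Nonempty) {p : ℕ} (hp : ∀ a ∈ S, A.count a % 2 = p % 2) :
    ∃ x, x % 2 = p % 2 ∧ (∀ a ∈ S, x ≤ A.count a) ∧
      ∀ q, (∀ a ∈ S, q ≤ A.count a ∧ q % 2 = A.count a % 2) ↔ q ≤ x ∧ q % 2 = x % 2 := by
  obtain ⟨b, hb, hmin⟩ := S.exists_min_image A.count hS
  refine ⟨A.count b, hp b hb, hmin, fun q => ⟨fun h => h b hb, fun h a ha => ?_⟩⟩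
  have := hmin a ha
  have := hp a ha
  have := hp b hb
  omega

section Theta

variable {G : Type*} [AddCommGroup G] [DecidableEq G]

/-- A theta: a five-element circuit `P ∪ Q` together with its chord `g`, which is the sum of the
pair `P` and of the triple `Q`. -/
structure IsTheta (P Q : Finset G) (g : G) : Prop where
  card_left : P.card = 2
  card_right : Q.card = 3
  disjoint : Disjoint P Q
  sum_left : ∑ x ∈ P, x = g
  isCircuit_union : IsCircuit (P ∪ Q)

theorem IsTheta.card_union {P Q : Finset G} {g : G} (h : IsTheta P Q g) : (P ∪ Q).card = 5 := by
  rw [Finset.card_union_of_disjoint h.disjoint, h.card_left, h.card_right]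

variable [Module (ZMod 2) G]

theorem IsCircuit.insert_sum {U S : Finset G} (hU : IsCircuit U) (hS : S ⊆ U) (h2 : 2 ≤ S.card)
    (hlt : S.card + 1 < U.card) : ∑ x ∈ S, x ∉ U ∧ IsCycle (insert (∑ x ∈ S, x) S) := by
  have sum_ne {T : Finset G} (hT : T ⊆ U) (hT0 : 0 < T.card) (hTU : T.card < U.card) :
      ∑ x ∈ T, x ≠ 0 := fun h => hTU.ne
    (congrArg Finset.card (hU.eq_of_subset (hU.isCycle.mono_sum hT h) (Finset.card_pos.1 hT0) hT))
  have hne := sum_ne hS (by omega) (by omega)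
  set g := ∑ x ∈ S, x with hg
  have hgS : g ∉ S := fun h => by
    have hc := Finset.card_erase_of_mem h
    refine sum_ne ((Finset.erase_subset g S).trans hS) (by omega) (by omega) ?_
    rw [Finset.sum_erase_eq_sub h, ← hg, sub_self]
  have hs : ∑ x ∈ insert g S, x = 0 := by
    rw [Finset.sum_insert hgS, ← hg, ZModModule.add_self]
  refine ⟨fun hgU => ?_, ?_, hs⟩
  · refine sum_ne (Finset.insert_subset hgU hS) ?_ ?_ hs <;>
      rw [Finset.card_insert_of_notMem hgS] <;> omega
  · rw [Finset.mem_insert, not_or]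
    exact ⟨hne.symm, fun h0 => hU.isCycle.zero_notMem (hS h0)⟩

namespace IsTheta

variable {P Q : Finset G} {g : G}

theorem notMem_union (h : IsTheta P Q g) : g ∉ P ∪ Q := by
  have := h.isCircuit_union.insert_sum Finset.subset_union_left h.card_left.ge
    (by rw [h.card_union, h.card_left]; norm_num)
  exact h.sum_left ▸ this.1

theorem isCircuit_insert_left (h : IsTheta P Q g) : IsCircuit (insert g P) := by
  have := h.isCircuit_union.insert_sum Finset.subset_union_left h.card_left.ge
    (by rw [h.card_union, h.card_left]; norm_num)
  refine (h.sum_left ▸ this.2).isCircuit (Finset.insert_nonempty g P) ?_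
  exact (Finset.card_insert_le g P).trans (by rw [h.card_left]; norm_num)

theorem union_symmDiff_insert_left (h : IsTheta P Q g) : (P ∪ Q) ∆ insert g P = insert g Q := by
  have hd := Finset.disjoint_left.1 h.disjoint
  have hg := h.notMem_union
  ext x
  simp only [Finset.mem_symmDiff, Finset.mem_union, Finset.mem_insert] at hg ⊢
  grind

theorem isCircuit_insert_right (h : IsTheta P Q g) : IsCircuit (insert g Q) := by
  have := h.isCircuit_union.isCycle.symmDiff h.isCircuit_insert_left.isCycle
  rw [h.union_symmDiff_insert_left] at this
  refine this.isCircuit (Finset.insert_nonempty g Q) ?_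
  exact (Finset.card_insert_le g Q).trans (by rw [h.card_right]; norm_num)

theorem card_insert_left (h : IsTheta P Q g) : (insert g P).card = 3 := by
  rw [Finset.card_insert_of_notMem fun hg => h.notMem_union (Finset.mem_union_left Q hg),
    h.card_left]

theorem card_insert_right (h : IsTheta P Q g) : (insert g Q).card = 4 := by
  rw [Finset.card_insert_of_notMem fun hg => h.notMem_union (Finset.mem_union_right P hg),
    h.card_right]

theorem zero_notMem (h : IsTheta P Q g) : 0 ∉ insert g (P ∪ Q) := by
  have hP := h.isCircuit_insert_left.isCycle.zero_notMem
  have hQ := h.isCircuit_union.isCycle.zero_notMem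
  simp only [Finset.mem_insert, not_or] at hP ⊢
  exact ⟨hP.1, hQ⟩

theorem eq_of_isCircuit (h : IsTheta P Q g) {C : Finset G} (hC : IsCircuit C)
    (hsub : C ⊆ insert g (P ∪ Q)) : C = insert g P ∨ C = insert g Q ∨ C = P ∪ Q := by
  by_cases hg : g ∈ C
  · have hD := hC.isCycle.symmDiff h.isCircuit_insert_left.isCycle
    have hDU : C ∆ insert g P ⊆ P ∪ Q := fun x hx => by
      have := @hsub x
      simp only [Finset.mem_symmDiff, Finset.mem_insert, Finset.mem_union] at hx this ⊢
      grind
    obtain h0 | hne := (C ∆ insert g P).eq_empty_or_nonempty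
    · exact .inl (symmDiff_eq_bot.1 h0)
    · refine .inr (.inl ?_)
      rw [← h.union_symmDiff_insert_left, ← h.isCircuit_union.eq_of_subset hD hne hDU,
        symmDiff_symmDiff_cancel_right]
  · exact .inr (.inr (h.isCircuit_union.eq_of_subset hC.isCycle hC.nonempty
      ((Finset.subset_insert_iff_of_notMem hg).1 hsub)))

theorem cover_eq (h : IsTheta P Q g) {F : Multiset (Finset G)} (hF : ∀ C ∈ F, IsCircuit C)
    (hsub : ∀ C ∈ F, C ⊆ insert g (P ∪ Q)) : ∃ s t u,
      cover F = s • (insert g P).val + t • (insert g Q).val + u • (P ∪ Q).val ∧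
      weight F = s + 2 * t + 3 * u := by
  induction F using Multiset.induction_on with
  | empty => exact ⟨0, 0, 0, by simp, rfl⟩
  | cons C F ih =>
    rw [Multiset.forall_mem_cons] at hF hsub
    obtain ⟨s, t, u, hc, hw⟩ := ih hF.2 hsub.2
    rw [cover_cons, weight_cons, hc, hw]
    obtain rfl | rfl | rfl := h.eq_of_isCircuit hF.1 hsub.1
    · exact ⟨s + 1, t, u, by rw [succ_nsmul]; abel, by rw [h.card_insert_left]; omega⟩
    · exact ⟨s, t + 1, u, by rw [succ_nsmul]; abel, by rw [h.card_insert_right]; omega⟩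
    · exact ⟨s, t, u + 1, by rw [succ_nsmul]; abel, by rw [h.card_union]; omega⟩

theorem add_circuits_eq (h : IsTheta P Q g) (s t u : ℕ) :
    s • (insert g P).val + t • (insert g Q).val + u • (P ∪ Q).val =
      thetaSeq P Q g (s + u) (t + u) (s + t) := by
  have hd := Finset.disjoint_left.1 h.disjoint
  have hg := h.notMem_union
  ext x
  simp only [count_thetaSeq, Multiset.count_add, Multiset.count_nsmul, count_val,
    Finset.mem_union, Finset.mem_insert] at hg ⊢
  have := @hd x
  split_ifs <;> grind

theorem hasWeight_thetaSeq (h : IsTheta P Q g) (s t u : ℕ) :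
    HasWeight (thetaSeq P Q g (s + u) (t + u) (s + t)) (s + 2 * t + 3 * u) := by
  rw [← h.add_circuits_eq]
  have hs := h.isCircuit_insert_left.hasWeight.nsmul s
  have ht := h.isCircuit_insert_right.hasWeight.nsmul t
  have hu := h.isCircuit_union.hasWeight.nsmul u
  rw [h.card_insert_left] at hs
  rw [h.card_insert_right] at ht
  rw [h.card_union] at hu
  convert (hs.add ht).add hu using 1
  ring

theorem count_eq (h : IsTheta P Q g) (p q r : ℕ) :
    (∀ a ∈ P, (thetaSeq P Q g p q r).count a = p) ∧
    (∀ a ∈ Q, (thetaSeq P Q g p q r).count a = q) ∧ (thetaSeq P Q g p q r).count g = r := by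
  have hd := Finset.disjoint_left.1 h.disjoint
  have hg := h.notMem_union
  simp only [count_thetaSeq, Finset.mem_union] at hg ⊢
  grind

theorem hasWeight_iff (h : IsTheta P Q g) {A : Multiset G} (hA : ∀ a ∈ A, a ∈ insert g (P ∪ Q))
    {x y : ℕ}
    (hx : ∀ p, (∀ a ∈ P, p ≤ A.count a ∧ p % 2 = A.count a % 2) ↔ p ≤ x ∧ p % 2 = x % 2)
    (hy : ∀ q, (∀ a ∈ Q, q ≤ A.count a ∧ q % 2 = A.count a % 2) ↔ q ≤ y ∧ q % 2 = y % 2)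
    (hxyz : (x + y + A.count g) % 2 = 0) {w : ℕ} :
    HasWeight A w ↔ ThetaWeight x y (A.count g) w := by
  constructor
  · rintro ⟨F, hF, ⟨R, rfl⟩, rfl⟩
    obtain ⟨s, t, u, hc, hw⟩ := h.cover_eq hF fun C hC a ha =>
      hA a (Multiset.mem_add.2 (.inl (mem_cover.2 ⟨C, hC, ha⟩)))
    rw [h.add_circuits_eq] at hc
    simp only [hc, Multiset.count_add, Multiset.count_nsmul] at hx hy ⊢
    obtain ⟨hP, hQ, hg⟩ := h.count_eq (s + u) (t + u) (s + t)
    obtain ⟨hp, hp2⟩ := (hx (s + u)).1 fun a ha => by rw [hP a ha]; omega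
    obtain ⟨hq, hq2⟩ := (hy (t + u)).1 fun a ha => by rw [hQ a ha]; omega
    exact ⟨s + u, t + u, hp, hp2, hq, hq2, by omega, by omega, by omega⟩
  · rintro ⟨p, q, hp, hp2, hq, hq2, hpq, hqp, rfl⟩
    have hw := h.hasWeight_thetaSeq (p - q) (q - p) (min p q)
    rw [show p - q + min p q = p by omega, show q - p + min p q = q by omega,
      show p - q + 2 * (q - p) + 3 * min p q = p + 2 * q by omega] at hw
    refine hw.mono fun a => ?_
    obtain ⟨hP, hQ, hg⟩ := h.count_eq p q (p - q + (q - p))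
    by_cases haP : a ∈ P
    · rw [hP a haP]
      exact (hx p).2 ⟨hp, hp2⟩ a haP
    by_cases haQ : a ∈ Q
    · rw [hQ a haQ]
      exact (hy q).2 ⟨hq, hq2⟩ a haQ
    by_cases hag : a = g
    · rw [hag, hg]
      omega
    · have haA : a ∉ A := fun ha => by simpa [haP, haQ, hag] using hA a ha
      rw [Multiset.count_eq_zero_of_notMem haA, count_thetaSeq, if_neg haP, if_neg haQ,
        if_neg hag]
      exact ⟨le_rfl, rfl⟩

theorem exists_hasWeight_iff (h : IsTheta P Q g) {A : Multiset G}
    (hA : ∀ a ∈ A, a ∈ insert g (P ∪ Q)) (hs : A.sum = 0) :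
    ∃ x y z, (x + y + z) % 2 = 0 ∧ 2 * x + 3 * y + z ≤ A.card ∧
      ∀ w, HasWeight A w ↔ ThetaWeight x y z w := by
  obtain ⟨-, F, hF, ⟨R, hFA⟩, -⟩ := exists_hasWeight (fun h0 => h.zero_notMem (hA 0 h0)) hs
  obtain ⟨s, t, u, hc, -⟩ := h.cover_eq hF fun C hC a ha =>
    hA a (hFA ▸ Multiset.mem_add.2 (.inl (mem_cover.2 ⟨C, hC, ha⟩)))
  rw [h.add_circuits_eq] at hc
  have hcount (a : G) : A.count a = (thetaSeq P Q g (s + u) (t + u) (s + t)).count a +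
      2 * R.count a := by
    rw [← hFA, hc, Multiset.count_add, Multiset.count_nsmul]
  obtain ⟨hP, hQ, hg⟩ := h.count_eq (s + u) (t + u) (s + t)
  obtain ⟨x, hx2, hxA, hx⟩ := exists_forall_le_count_iff (A := A) (S := P) (p := s + u)
    (Finset.card_pos.1 (by rw [h.card_left]; norm_num)) fun a ha => by
      rw [hcount, hP a ha]; omega
  obtain ⟨y, hy2, hyA, hy⟩ := exists_forall_le_count_iff (A := A) (S := Q) (p := t + u)
    (Finset.card_pos.1 (by rw [h.card_right]; norm_num)) fun a ha => by
      rw [hcount, hQ a ha]; omega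
  have hz2 := hcount g
  rw [hg] at hz2
  have hxyz : (x + y + A.count g) % 2 = 0 := by omega
  refine ⟨x, y, A.count g, hxyz, ?_, fun w => h.hasWeight_iff hA hx hy hxyz⟩
  have hle : thetaSeq P Q g x y (A.count g) ≤ A := Multiset.le_iff_count.2 fun a => by
    obtain ⟨hP, hQ, -⟩ := h.count_eq x y (A.count g)
    by_cases haP : a ∈ P
    · exact (hP a haP).trans_le (hxA a haP)
    by_cases haQ : a ∈ Q
    · exact (hQ a haQ).trans_le (hyA a haQ)
    simp only [count_thetaSeq, haP, haQ, if_false, zero_add]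
    split_ifs with hag
    · rw [hag]
    · exact Nat.zero_le _
  have := Multiset.card_le_card hle
  simp only [thetaSeq, Multiset.card_add, Multiset.card_nsmul, Finset.card_val, h.card_left,
    h.card_right, Multiset.card_singleton] at this
  omega

end IsTheta

end Theta

theorem IsTheta.of_subset {G : Type*} [AddCommGroup G] [DecidableEq G] {U P : Finset G}
    {g : G} (hU : IsCircuit U) (hU5 : U.card = 5) (hP : P ⊆ U) (hP2 : P.card = 2)
    (hg : ∑ x ∈ P, x = g) : IsTheta P (U \ P) g where
  card_left := hP2
  card_right := by rw [Finset.card_sdiff_of_subset hP, hU5, hP2]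
  disjoint := Finset.disjoint_sdiff
  sum_left := hg
  isCircuit_union := by rwa [Finset.union_sdiff_of_subset hP]

section Exchange

variable {G : Type*} [AddCommGroup G] [Module (ZMod 2) G] [DecidableEq G]
  {P Q V : Finset G} {g : G} {w : ℕ}

namespace IsTheta

variable (h : IsTheta P Q g)
include h

theorem hasWeight_left (hg : g ∈ V) (hw : HasWeight (V ∆ insert g Q).val w) :
    HasWeight ((P ∪ Q).val + V.val) (1 + w) := by
  have hd := Finset.disjoint_left.1 h.disjoint
  have hgU := h.notMem_union
  have hP := h.isCircuit_insert_left.hasWeight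
  rw [h.card_insert_left] at hP
  refine (hP.add hw).mono fun x => ?_
  have := @hd x
  simp only [Multiset.count_add, count_val, Finset.mem_symmDiff, Finset.mem_insert,
    Finset.mem_union] at hgU ⊢
  grind

theorem hasWeight_right (hg : g ∈ V) (hw : HasWeight (V ∆ insert g P).val w) :
    HasWeight ((P ∪ Q).val + V.val) (2 + w) := by
  have hd := Finset.disjoint_left.1 h.disjoint
  have hgU := h.notMem_union
  have hQ := h.isCircuit_insert_right.hasWeight
  rw [h.card_insert_right] at hQ
  refine (hQ.add hw).mono fun x => ?_
  have := @hd x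
  simp only [Multiset.count_add, count_val, Finset.mem_symmDiff, Finset.mem_insert,
    Finset.mem_union] at hgU ⊢
  grind

end IsTheta

theorem IsTheta.card_inter_left {V : Finset G} (h : IsTheta P Q g) (hV : IsCircuit V)
    (hV4 : V.card = 4) (hUV : ((P ∪ Q) ∩ V).card = 3) (hg : g ∉ V) :
    (V ∩ P).card + (V ∩ Q).card = 3 ∧ ((V ∩ P).card = 1 ∨ (V ∩ P).card = 2) := by
  have hsum : (V ∩ P).card + (V ∩ Q).card = 3 := by
    rw [← Finset.card_union_of_disjoint (h.disjoint.mono Finset.inter_subset_right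
      Finset.inter_subset_right), ← Finset.inter_union_distrib_left, Finset.inter_comm, hUV]
  have hle := Finset.card_le_card (Finset.inter_subset_right (s₁ := V) (s₂ := P))
  rw [h.card_left] at hle
  refine ⟨hsum, ?_⟩
  by_contra h0
  have hc := card_symmDiff_add V (insert g Q)
  rw [Finset.inter_insert_of_notMem hg, h.card_insert_right, hV4] at hc
  have := (hV.isCycle.symmDiff h.isCircuit_insert_right.isCycle).three_le_card
    (Finset.card_pos.1 (by omega))
  omega

end Exchange

section E4

variable {U V W T : Finset E4} {g : E4}

theorem IsCircuit.exists_isTheta (hU : IsCircuit U) (hU5 : U.card = 5) (hg : g ∉ U) (hg0 : g ≠ 0) :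
    ∃ P Q, IsTheta P Q g ∧ P ∪ Q = U := by
  obtain ⟨e, he⟩ := hU.nonempty
  obtain ⟨Y, hYX, hne, hY⟩ := exists_isCycle_of_five_le_card (X := insert g (U.erase e))
    (by simp [hg0.symm, hU.isCycle.zero_notMem])
    (by rw [Finset.card_insert_of_notMem (by simp [hg]), Finset.card_erase_of_mem he, hU5])
  have heY : e ∉ Y := fun h => by
    obtain rfl | h := Finset.mem_insert.1 (hYX h)
    exacts [hg he, Finset.notMem_erase e U h]
  have hgY : g ∈ Y := by
    by_contra hgY
    refine heY (hU.eq_of_subset hY hne ?_ ▸ he)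
    exact ((Finset.subset_insert_iff_of_notMem hgY).1 hYX).trans (Finset.erase_subset e U)
  have hZU : Y.erase g ⊆ U.erase e := Finset.subset_insert_iff.1 hYX
  have hZU' := hZU.trans (Finset.erase_subset e U)
  have hZ : ∑ x ∈ Y.erase g, x = g := by
    rw [Finset.sum_erase_eq_sub hgY, hY.sum_eq_zero, zero_sub, ZModModule.neg_eq_self]
  have hZs : ∑ x ∈ U \ Y.erase g, x = g := by
    rw [Finset.sum_sdiff_eq_sub hZU', hU.isCycle.sum_eq_zero, hZ, zero_sub, ZModModule.neg_eq_self]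
  have hY3 := hY.three_le_card hne
  have hZ2 := Finset.card_erase_of_mem hgY
  have hZ4 := Finset.card_le_card hZU
  have hZc := Finset.card_sdiff_add_card_eq_card hZU'
  rw [Finset.card_erase_of_mem he, hU5] at hZ4
  obtain h2 | h3 | h4 : (Y.erase g).card = 2 ∨ (Y.erase g).card = 3 ∨ (Y.erase g).card = 4 := by
    omega
  · exact ⟨Y.erase g, U \ Y.erase g, IsTheta.of_subset hU hU5 hZU' h2 hZ,
      Finset.union_sdiff_of_subset hZU'⟩
  · exact ⟨U \ Y.erase g, U \ (U \ Y.erase g), IsTheta.of_subset hU hU5 Finset.sdiff_subset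
      (by omega) hZs, Finset.union_sdiff_of_subset Finset.sdiff_subset⟩
  · obtain ⟨c, hc⟩ := Finset.card_eq_one.1 (show (U \ Y.erase g).card = 1 by omega)
    rw [hc, Finset.sum_singleton] at hZs
    exact absurd (Finset.mem_sdiff.1 (hc ▸ Finset.mem_singleton_self c)).1 (hZs ▸ hg)

theorem IsCycle.hasWeight_two {X : Finset E4} (hX : IsCycle X) (hc : X.card = 4 ∨ X.card = 6) :
    HasWeight X.val 2 := by
  obtain h4 | h6 := hc
  · have := (hX.isCircuit (Finset.card_pos.1 (by omega)) (by omega)).hasWeight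
    rwa [h4] at this
  · have := hX.hasWeight_of_card_le_eight (by omega) (by omega)
    rwa [h6] at this

theorem hasWeight_five_add_five (hU : IsCircuit U) (hV : IsCircuit V) (hU5 : U.card = 5)
    (hV5 : V.card = 5) (hne : U ≠ V) : HasWeight (U.val + V.val) 4 := by
  obtain ⟨g, hgV, hgU⟩ : ∃ g ∈ V, g ∉ U := Finset.not_subset.1 fun hVU =>
    hne (hU.eq_of_subset hV.isCycle hV.nonempty hVU).symm
  obtain ⟨P, Q, h, rfl⟩ :=
    hU.exists_isTheta hU5 hgU (ne_of_mem_of_not_mem hgV hV.isCycle.zero_notMem)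
  refine h.hasWeight_right hgV
    ((hV.isCycle.symmDiff h.isCircuit_insert_left.isCycle).hasWeight_two ?_)
  have hc := card_symmDiff_add V (insert g P)
  have hle := Finset.card_le_card (Finset.inter_subset_right (s₁ := V) (s₂ := insert g P))
  have hlt : (V ∩ insert g P).card ≠ 3 := fun h3 => by
    have hPV : insert g P ⊆ V := Finset.inter_eq_right.1
      (Finset.eq_of_subset_of_card_le Finset.inter_subset_right (by rw [h.card_insert_left, h3]))
    have := hV.eq_of_subset h.isCircuit_insert_left.isCycle (Finset.insert_nonempty g P) hPV
    have := h.card_insert_left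
    simp_all
  have hpos : 0 < (V ∩ insert g P).card :=
    Finset.card_pos.2 ⟨g, Finset.mem_inter.2 ⟨hgV, Finset.mem_insert_self g P⟩⟩
  rw [h.card_insert_left] at hc hle
  omega

theorem hasWeight_five_add_four (hU : IsCircuit U) (hV : IsCircuit V) (hU5 : U.card = 5)
    (hV4 : V.card = 4) (hd : Disjoint U V) : HasWeight (U.val + V.val) 3 := by
  obtain ⟨g, hgV⟩ := hV.nonempty
  obtain ⟨P, Q, h, rfl⟩ := hU.exists_isTheta hU5 (Finset.disjoint_right.1 hd hgV)
    (ne_of_mem_of_not_mem hgV hV.isCycle.zero_notMem)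
  refine h.hasWeight_left hgV
    ((hV.isCycle.symmDiff h.isCircuit_insert_right.isCycle).hasWeight_two (.inr ?_))
  have hc := card_symmDiff_add V (insert g Q)
  rw [Finset.inter_insert_of_mem hgV, Finset.disjoint_iff_inter_eq_empty.1
    (Finset.disjoint_union_left.1 hd).2.symm, hV4, h.card_insert_right] at hc
  simpa using hc

theorem hasWeight_two_nsmul_five_add_three (hU : IsCircuit U) (hT : IsCircuit T)
    (hU5 : U.card = 5) (hT3 : T.card = 3) (hd : Disjoint U T) :
    HasWeight (2 • U.val + T.val) 5 := by
  obtain ⟨g, hgT⟩ := hT.nonempty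
  obtain ⟨P, Q, h, rfl⟩ := hU.exists_isTheta hU5 (Finset.disjoint_right.1 hd hgT)
    (ne_of_mem_of_not_mem hgT hT.isCycle.zero_notMem)
  have hc := card_symmDiff_add T (insert g Q)
  rw [Finset.inter_insert_of_mem hgT, Finset.disjoint_iff_inter_eq_empty.1
    (Finset.disjoint_union_left.1 hd).2.symm, hT3, h.card_insert_right,
    show (insert g (∅ : Finset E4)).card = 1 from rfl] at hc
  have h4 := h.isCircuit_insert_right.hasWeight
  have h5 := ((hT.isCycle.symmDiff h.isCircuit_insert_right.isCycle).isCircuit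
    (Finset.card_pos.1 (by omega)) (by omega)).hasWeight
  rw [h.card_insert_right] at h4
  rw [show (T ∆ insert g Q).card = 5 by omega] at h5
  refine (h4.add h5).mono fun x => ?_
  have := @Finset.disjoint_left.1 hd x
  have hgU := h.notMem_union
  simp only [Multiset.count_add, Multiset.count_nsmul, count_val, Finset.mem_symmDiff,
    Finset.mem_insert, Finset.mem_union] at this hgU ⊢
  grind

theorem hasWeight_two_nsmul_five_add_square (hU : IsCircuit U) (hU5 : U.card = 5) (hg : g ∉ U)
    (hg0 : g ≠ 0) : HasWeight (2 • U.val + 2 • {g}) 4 := by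
  obtain ⟨P, Q, h, rfl⟩ := hU.exists_isTheta hU5 hg hg0
  have h4 := h.isCircuit_insert_right.hasWeight
  rw [h.card_insert_right] at h4
  refine (h4.add h4).mono fun x => ?_
  simp only [Multiset.count_add, Multiset.count_nsmul, count_val, Finset.mem_insert,
    Finset.mem_union, Multiset.count_singleton] at hg ⊢
  grind

theorem hasWeight_five_add_four_add_three (hU : IsCircuit U) (hV : IsCircuit V) (hT : IsCircuit T)
    (hU5 : U.card = 5) (hV4 : V.card = 4) (hT3 : T.card = 3) (hUV : (U ∩ V).card = 3)
    (hUT : Disjoint U T) (hVT : Disjoint V T) : HasWeight (U.val + V.val + T.val) 4 := by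
  obtain ⟨p, hp⟩ := hT.nonempty
  obtain ⟨P, Q, h, rfl⟩ := hU.exists_isTheta hU5 (Finset.disjoint_right.1 hUT hp)
    (ne_of_mem_of_not_mem hp hT.isCycle.zero_notMem)
  have hpV := Finset.disjoint_right.1 hVT hp
  have hPV := h.card_inter_left hV hV4 hUV hpV
  have hpVT : p ∈ V ∆ T := Finset.mem_symmDiff.2 (.inr ⟨hp, hpV⟩)
  have hinter : (V ∆ T) ∩ P = V ∩ P := by
    ext x
    have := @Finset.disjoint_left.1 hUT x
    simp only [Finset.mem_inter, Finset.mem_symmDiff, Finset.mem_union] at this ⊢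
    tauto
  have hc := card_symmDiff_add (V ∆ T) (insert p P)
  have hpP : p ∉ V ∩ P := fun h => hpV (Finset.mem_inter.1 h).1
  rw [Finset.inter_insert_of_mem hpVT, hinter, Finset.card_insert_of_notMem hpP,
    h.card_insert_left] at hc
  have hVTc := card_symmDiff_add V T
  rw [Finset.disjoint_iff_inter_eq_empty.1 hVT, Finset.card_empty] at hVTc
  refine (h.hasWeight_right hpVT (((hV.isCycle.symmDiff hT.isCycle).symmDiff
    h.isCircuit_insert_left.isCycle).hasWeight_two (by omega))).mono fun x => ?_
  simp only [Multiset.count_add, count_val, Finset.mem_symmDiff]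
  grind

theorem hasWeight_five_add_four_add_square (hU : IsCircuit U) (hV : IsCircuit V)
    (hU5 : U.card = 5) (hV4 : V.card = 4) (hUV : (U ∩ V).card = 3) (hgU : g ∉ U) (hgV : g ∉ V)
    (hg0 : g ≠ 0) : HasWeight (U.val + V.val + 2 • {g}) 3 := by
  obtain ⟨P, Q, h, rfl⟩ := hU.exists_isTheta hU5 hgU hg0
  have hPV := h.card_inter_left hV hV4 hUV hgV
  have hc := card_symmDiff_add V (insert g Q)
  rw [Finset.inter_insert_of_notMem hgV, h.card_insert_right, hV4] at hc
  have h3 := h.isCircuit_insert_left.hasWeight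
  rw [h.card_insert_left] at h3
  refine (h3.add ((hV.isCycle.symmDiff h.isCircuit_insert_right.isCycle).hasWeight_two
    (by omega))).mono fun x => ?_
  have := @Finset.disjoint_left.1 h.disjoint x
  simp only [Multiset.count_add, Multiset.count_nsmul, count_val, Finset.mem_symmDiff,
    Finset.mem_insert, Finset.mem_union, Multiset.count_singleton] at hgU ⊢
  grind

end E4

section FourCircuit

variable {G : Type*} [AddCommGroup G] [Module (ZMod 2) G] {V S T : Finset G} {g : G}

theorem IsCircuit.sum_mem_of_card_odd (hV : IsCircuit V) (hV4 : V.card = 4) (hS : S ⊆ V)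
    (h : S.card = 1 ∨ S.card = 3) : ∑ x ∈ S, x ∈ V := by
  classical
  obtain h1 | h3 := h
  · obtain ⟨v, rfl⟩ := Finset.card_eq_one.1 h1
    simpa using hS
  · have hc := Finset.card_sdiff_add_card_eq_card hS
    obtain ⟨v, hv⟩ := Finset.card_eq_one.1 (show (V \ S).card = 1 by omega)
    have hs := Finset.sum_sdiff hS (f := fun x => x)
    rw [hV.isCycle.sum_eq_zero, hv, Finset.sum_singleton, ← ZModModule.sub_eq_add,
      sub_eq_zero] at hs
    exact hs ▸ (Finset.mem_sdiff.1 (hv ▸ Finset.mem_singleton_self v)).1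

theorem hasWeight_of_sum_eq (hS0 : 0 ∉ S) (hT0 : 0 ∉ T) (hd : Disjoint S T) (hS2 : S.card = 2)
    (hT3 : T.card ≤ 3) (hST : ∑ x ∈ S, x = ∑ x ∈ T, x) : HasWeight (S.val + T.val) T.card := by
  classical
  have hcyc : IsCycle (S ∪ T) :=
    { zero_notMem := by simp [hS0, hT0]
      sum_eq_zero := by rw [Finset.sum_union hd, hST, ZModModule.add_self] }
  have hc := Finset.card_union_of_disjoint hd
  have hw := (hcyc.isCircuit (Finset.card_pos.1 (by omega)) (by omega)).hasWeight
  rw [hc, hS2, Nat.add_sub_cancel_left] at hw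
  exact hw.mono fun x => by
    have := @Finset.disjoint_left.1 hd x
    simp only [Multiset.count_add, count_val, Finset.mem_union]
    grind

theorem IsCircuit.forall_sum_ne (hV : IsCircuit V) (hV4 : V.card = 4) (hgV : g ∉ V) (hg0 : g ≠ 0)
    (hg : ∀ S ⊆ V, S.card = 2 → ∑ x ∈ S, x ≠ g) : ∀ S ⊆ V, ∑ x ∈ S, x ≠ g := by
  intro S hS h
  have hle := Finset.card_le_card hS
  obtain h0 | h2 | h4 | hodd :
      S.card = 0 ∨ S.card = 2 ∨ S.card = 4 ∨ S.card = 1 ∨ S.card = 3 := by omega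
  · rw [Finset.card_eq_zero.1 h0, Finset.sum_empty] at h
    exact hg0 h.symm
  · exact hg S hS h2 h
  · rw [Finset.eq_of_subset_of_card_le hS (by omega), hV.isCycle.sum_eq_zero] at h
    exact hg0 h.symm
  · exact hgV (h ▸ hV.sum_mem_of_card_odd hV4 hS hodd)

variable [DecidableEq G]

theorem isCircuit_insert_sum (hS0 : 0 ∉ S) (hS2 : S.card = 2) :
    IsCircuit (insert (∑ x ∈ S, x) S) ∧ (insert (∑ x ∈ S, x) S).card = 3 := by
  obtain ⟨a, b, hab, rfl⟩ := Finset.card_eq_two.1 hS2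
  simp only [Finset.mem_insert, Finset.mem_singleton, not_or] at hS0
  rw [Finset.sum_pair hab]
  have hne : a + b ≠ 0 := fun h => hab (by rwa [← sub_eq_zero, ZModModule.sub_eq_add])
  have hmem : a + b ∉ ({a, b} : Finset G) := by
    simpa using ⟨Ne.symm hS0.2, Ne.symm hS0.1⟩
  have hc : (insert (a + b) ({a, b} : Finset G)).card = 3 := by
    rw [Finset.card_insert_of_notMem hmem, hS2]
  have hcyc : IsCycle (insert (a + b) ({a, b} : Finset G)) :=
    { zero_notMem := by simp [hne.symm, hS0]
      sum_eq_zero := by rw [Finset.sum_insert hmem, Finset.sum_pair hab, ZModModule.add_self] }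
  exact ⟨hcyc.isCircuit (Finset.insert_nonempty _ _) (by omega), hc⟩

end FourCircuit

section FourCircuitRankFour

variable {V W : Finset E4} {p q : E4}

theorem IsCircuit.exists_sum_eq (hV : IsCircuit V) (hV4 : V.card = 4) (hp : p ∉ V) (hp0 : p ≠ 0)
    (hq : q ∉ V) (hq0 : q ≠ 0) (hpq : p ≠ q) :
    p + q ∈ V ∨ ∃ S ⊆ V, S.card = 2 ∧ (∑ x ∈ S, x = p ∨ ∑ x ∈ S, x = q ∨ ∑ x ∈ S, x = p + q) := by
  obtain ⟨d, hd⟩ := hV.nonempty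
  obtain ⟨Y, hYX, hne, hY⟩ := exists_isCycle_of_five_le_card (X := {p, q} ∪ V.erase d)
    (by simp [hp0.symm, hq0.symm, hV.isCycle.zero_notMem])
    (by rw [Finset.card_union_of_disjoint (by simp [hp, hq]), Finset.card_pair hpq,
          Finset.card_erase_of_mem hd, hV4])
  have hdY : d ∉ Y := fun h => by
    have := hYX h
    simp only [Finset.mem_union, Finset.mem_insert, Finset.mem_singleton,
      Finset.notMem_erase, or_false] at this
    obtain rfl | rfl := this <;> contradiction
  have hout : ∑ x ∈ Y \ V, x = p ∨ ∑ x ∈ Y \ V, x = q ∨ ∑ x ∈ Y \ V, x = p + q := by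
    have hsub : Y \ V ⊆ {p, q} := fun x hx => by
      obtain ⟨hxY, hxV⟩ := Finset.mem_sdiff.1 hx
      exact (Finset.mem_union.1 (hYX hxY)).resolve_right fun h => hxV (Finset.mem_of_mem_erase h)
    rw [← Finset.coe_subset, Finset.coe_pair, Set.subset_pair_iff_eq] at hsub
    norm_cast at hsub
    obtain h | h | h | h := hsub
    · exact absurd hd (hV.eq_of_subset hY hne (Finset.sdiff_eq_empty_iff_subset.1 h) ▸ hdY)
    all_goals simp [h, Finset.sum_pair hpq]
  have hsum : ∑ x ∈ Y ∩ V, x = ∑ x ∈ Y \ V, x := by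
    rw [← sub_eq_zero, ZModModule.sub_eq_add, Finset.sum_inter_add_sum_sdiff, hY.sum_eq_zero]
  have hle := Finset.card_le_card (Finset.subset_erase.2
    ⟨Finset.inter_subset_right (s₁ := Y) (s₂ := V), fun h => hdY (Finset.mem_inter.1 h).1⟩)
  rw [Finset.card_erase_of_mem hd, hV4] at hle
  by_cases h2 : (Y ∩ V).card = 2
  · exact .inr ⟨_, Finset.inter_subset_right, h2, hsum ▸ hout⟩
  have hpq0 : p + q ≠ 0 := fun h => hpq (by rwa [← sub_eq_zero, ZModModule.sub_eq_add])
  have hodd : (Y ∩ V).card = 1 ∨ (Y ∩ V).card = 3 := by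
    have h0 : (Y ∩ V).card ≠ 0 := fun h => by
      rw [← hsum, Finset.card_eq_zero.1 h, Finset.sum_empty] at hout
      obtain h | h | h := hout
      exacts [hp0 h.symm, hq0 h.symm, hpq0 h.symm]
    omega
  have hmem := hV.sum_mem_of_card_odd hV4 Finset.inter_subset_right hodd
  rw [hsum] at hmem
  obtain h | h | h := hout
  exacts [absurd (h ▸ hmem) hp, absurd (h ▸ hmem) hq, .inl (h ▸ hmem)]

theorem IsCircuit.exists_sum_eq_sum (hV : IsCircuit V) (hV4 : V.card = 4) (hW : IsCircuit W)
    (hd : Disjoint V W) : ∃ S ⊆ V, ∃ T ⊆ W, S.card = 2 ∧ T.Nonempty ∧ T.card ≤ 2 ∧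
      ∑ x ∈ S, x = ∑ x ∈ T, x := by
  obtain ⟨p, hp, q, hq, r, hr, hpq, hpr, hqr⟩ := Finset.two_lt_card.1 hW.three_le_card
  have hnotMem {x : E4} (hx : x ∈ W) : x ∉ V := Finset.disjoint_right.1 hd hx
  have hne0 {x : E4} (hx : x ∈ W) : x ≠ 0 := ne_of_mem_of_not_mem hx hW.isCycle.zero_notMem
  by_contra! hno
  have hadd {x y : E4} (hx : x ∈ W) (hy : y ∈ W) (hxy : x ≠ y) : x + y ∈ V := by
    refine (hV.exists_sum_eq hV4 (hnotMem hx) (hne0 hx) (hnotMem hy) (hne0 hy) hxy).resolve_right ?_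
    rintro ⟨S, hS, hS2, h | h | h⟩
    · exact hno S hS {x} (by simpa) hS2 (by simp) (by simp) (by simpa)
    · exact hno S hS {y} (by simpa) hS2 (by simp) (by simp) (by simpa)
    · exact hno S hS {x, y} (by simp [Finset.insert_subset_iff, hx, hy]) hS2 (by simp)
        Finset.card_le_two (by rwa [Finset.sum_pair hxy])
  refine hno {p + q, p + r} ?_ {q, r} ?_ (Finset.card_pair (by simpa)) (by simp)
    Finset.card_le_two ?_
  · simp [Finset.insert_subset_iff, hadd hp hq hpq, hadd hp hr hpr]
  · simp [Finset.insert_subset_iff, hq, hr]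
  · rw [Finset.sum_pair (by simpa), Finset.sum_pair hqr, add_add_add_comm, ZModModule.add_self,
      zero_add]

theorem hasWeight_two_nsmul_four_add (hV : IsCircuit V) (hV4 : V.card = 4) (hW : IsCircuit W)
    (hW4 : W.card ≤ 4) (hd : Disjoint V W) : HasWeight (2 • V.val + W.val) W.card := by
  obtain ⟨S, hS, T, hT, hS2, hT0, hT2, hST⟩ := hV.exists_sum_eq_sum hV4 hW hd
  have hST' : ∑ x ∈ S, x = ∑ x ∈ W \ T, x := by
    rw [Finset.sum_sdiff_eq_sub hT, hW.isCycle.sum_eq_zero, hST, zero_sub, ZModModule.neg_eq_self]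
  have hT1 := Finset.card_pos.2 hT0
  have hc := Finset.card_sdiff_add_card_eq_card hT
  have hS0 := Finset.notMem_mono hS hV.isCycle.zero_notMem
  have hw := (hasWeight_of_sum_eq hS0 (Finset.notMem_mono hT hW.isCycle.zero_notMem)
    (hd.mono hS hT) hS2 (by omega) hST).add (hasWeight_of_sum_eq hS0
    (Finset.notMem_mono Finset.sdiff_subset hW.isCycle.zero_notMem)
    (hd.mono hS Finset.sdiff_subset) hS2 (by omega) hST')
  rw [add_comm T.card, hc] at hw
  refine hw.mono fun x => ?_
  have := @hS x
  have := @hT x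
  simp only [Multiset.count_add, Multiset.count_nsmul, count_val, Finset.mem_sdiff]
  grind

theorem IsCircuit.exists_three_or_hasWeight (hV : IsCircuit V) (hV4 : V.card = 4) (hp : p ∉ V)
    (hp0 : p ≠ 0) (hq : q ∉ V) (hq0 : q ≠ 0) (hpq : p ≠ q) :
    (∃ T ⊆ V ∪ {p, q}, IsCircuit T ∧ T.card = 3) ∨ HasWeight (V.val + 2 • {p, q}) 4 := by
  have of_pair {S : Finset E4} (hS : S ⊆ V ∪ {p, q}) (hS2 : S.card = 2)
      (hmem : ∑ x ∈ S, x ∈ V ∪ {p, q}) : ∃ T ⊆ V ∪ {p, q}, IsCircuit T ∧ T.card = 3 := by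
    have h0 : 0 ∉ V ∪ {p, q} := by simp [hV.isCycle.zero_notMem, hp0.symm, hq0.symm]
    exact ⟨_, Finset.insert_subset hmem hS, isCircuit_insert_sum (fun h => h0 (hS h)) hS2⟩
  obtain h | ⟨S, hS, hS2, h | h | h⟩ := hV.exists_sum_eq hV4 hp hp0 hq hq0 hpq
  · refine .inl (of_pair Finset.subset_union_right (Finset.card_pair hpq) ?_)
    exact Finset.mem_union_left _ (by rwa [Finset.sum_pair hpq])
  · exact .inl (of_pair (hS.trans Finset.subset_union_left) hS2 (by simp [h]))
  · exact .inl (of_pair (hS.trans Finset.subset_union_left) hS2 (by simp [h]))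
  · right
    have hS' : ∑ x ∈ V \ S, x = p + q := by
      rw [Finset.sum_sdiff_eq_sub hS, hV.isCycle.sum_eq_zero, h, zero_sub, ZModModule.neg_eq_self]
    have hV0 := hV.isCycle.zero_notMem
    have hpq0 : 0 ∉ ({p, q} : Finset E4) := by simp [hp0.symm, hq0.symm]
    have hd : Disjoint V {p, q} := by simp [hp, hq]
    have hw {S : Finset E4} (hS : S ⊆ V) (hS2 : S.card = 2) (h : ∑ x ∈ S, x = p + q) :
        HasWeight (S.val + ({p, q} : Finset E4).val) 2 := by
      have := hasWeight_of_sum_eq (Finset.notMem_mono hS hV0) hpq0 (hd.mono_left hS) hS2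
        (by rw [Finset.card_pair hpq]; norm_num) (by rw [h, Finset.sum_pair hpq])
      rwa [Finset.card_pair hpq] at this
    refine ((hw hS hS2 h).add (hw Finset.sdiff_subset
      (by rw [Finset.card_sdiff_of_subset hS, hV4, hS2]) hS')).mono fun x => ?_
    have := @hS x
    simp only [Multiset.count_add, Multiset.count_nsmul, count_val, Finset.mem_sdiff,
      Multiset.insert_eq_cons, Multiset.count_cons, Multiset.count_singleton, Finset.mem_insert,
      Finset.mem_singleton]
    grind

theorem IsCircuit.exists_forall_sum_ne (hV : IsCircuit V) (hV4 : V.card = 4) :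
    ∃ g, ∀ S ⊆ V, ∑ x ∈ S, x ≠ g := by
  obtain ⟨d, hd⟩ := hV.nonempty
  have hcard : ((V.erase d).powerset.image fun S => ∑ x ∈ S, x).card < Fintype.card E4 := by
    refine Finset.card_image_le.trans_lt ?_
    rw [Finset.card_powerset, Finset.card_erase_of_mem hd, hV4]
    simp
  obtain ⟨g, hg⟩ := Finset.exists_mem_notMem_of_card_lt_card (t := Finset.univ) hcard
  refine ⟨g, fun S hS h => hg.2 ?_⟩
  rw [Finset.mem_image]
  by_cases hdS : d ∈ S
  · refine ⟨V \ S, by grind, ?_⟩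
    rw [Finset.sum_sdiff_eq_sub hS, hV.isCycle.sum_eq_zero, h, zero_sub, ZModModule.neg_eq_self]
  · exact ⟨S, Finset.mem_powerset.2 (Finset.subset_erase.2 ⟨hS, hdS⟩), h⟩

end FourCircuitRankFour

section ThetaSupport

variable {G : Type*} [AddCommGroup G] [DecidableEq G] {U V : Finset G} {A : Multiset G}

/-- All terms of the sequence lie in a common theta. -/
def ThetaSupport (A : Multiset G) : Prop :=
  ∃ P Q g, IsTheta P Q g ∧ ∀ x ∈ A, x ∈ insert g (P ∪ Q)

theorem thetaSupport_of_five (hU : IsCircuit U) (hU5 : U.card = 5) (hA : ∀ x ∈ A, x ∈ U) :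
    ThetaSupport A := by
  obtain ⟨P, hP, hP2⟩ := Finset.exists_subset_card_eq (show 2 ≤ U.card by omega)
  refine ⟨P, U \ P, _, IsTheta.of_subset hU hU5 hP hP2 rfl, fun x hx => ?_⟩
  rw [Finset.union_sdiff_of_subset hP]
  exact Finset.mem_insert_of_mem (hA x hx)

theorem thetaSupport_of_five_four (hU : IsCircuit U) (hV : IsCircuit V) (hU5 : U.card = 5)
    (hV4 : V.card = 4) (hUV : (U ∩ V).card = 3) (hA : ∀ x ∈ A, x ∈ U ∨ x ∈ V) :
    ThetaSupport A := by
  have hUc := Finset.card_sdiff_add_card_inter U V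
  have hVc := Finset.card_sdiff_add_card_inter V U
  rw [Finset.inter_comm] at hVc
  obtain ⟨g, hg⟩ := Finset.card_eq_one.1 (show (V \ U).card = 1 by omega)
  have hsum : ∑ x ∈ U \ V, x = g := by
    have hsU := Finset.sum_inter_add_sum_sdiff U V fun x => x
    have hsV := Finset.sum_inter_add_sum_sdiff V U fun x => x
    rw [hg, Finset.sum_singleton, Finset.inter_comm, hV.isCycle.sum_eq_zero,
      ← hU.isCycle.sum_eq_zero, ← hsU] at hsV
    exact (add_left_cancel hsV).symm
  refine ⟨U \ V, U \ (U \ V), g, IsTheta.of_subset hU hU5 Finset.sdiff_subset (by omega) hsum,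
    fun x hx => ?_⟩
  rw [Finset.union_sdiff_of_subset Finset.sdiff_subset, Finset.mem_insert]
  have := hA x hx
  have := Finset.ext_iff.1 hg x
  grind

theorem thetaSupport_of_four [Module (ZMod 2) G] (hV : IsCircuit V) (hV4 : V.card = 4)
    {g : G} (hg : ∀ S ⊆ V, ∑ x ∈ S, x ≠ g) (hA : ∀ x ∈ A, x ∈ V ∨ x = g) : ThetaSupport A := by
  obtain ⟨d, hd⟩ := hV.nonempty
  have hgV : g ∉ V := fun h => hg {g} (by simpa) (by simp)
  have hg0 : g ≠ 0 := fun h => hg ∅ (by simp) (by simp [h])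
  have hd0 : d ≠ 0 := ne_of_mem_of_not_mem hd hV.isCycle.zero_notMem
  have hne : g + d ≠ 0 := fun h => hgV (by
    rw [← ZModModule.sub_eq_add, sub_eq_zero] at h
    rwa [h])
  have hgd : g + d ∉ V := fun h => by
    refine hg {g + d, d} (by simp [Finset.insert_subset_iff, h, hd]) ?_
    rw [Finset.sum_pair (by simpa), add_assoc, ZModModule.add_self, add_zero]
  have hd3 := Finset.card_erase_of_mem hd
  have hdis : Disjoint {g, g + d} (V.erase d) := by simp [hgV, hgd]
  have hU5 : ({g, g + d} ∪ V.erase d).card = 5 := by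
    rw [Finset.card_union_of_disjoint hdis, Finset.card_pair (by simpa), hd3, hV4]
  have hU : IsCycle ({g, g + d} ∪ V.erase d) :=
    { zero_notMem := by simp [hg0.symm, hne.symm, hV.isCycle.zero_notMem]
      sum_eq_zero := by
        rw [Finset.sum_union hdis, Finset.sum_pair (by simpa), ← add_assoc, ZModModule.add_self,
          zero_add]
        exact (Finset.add_sum_erase V (fun x => x) hd).trans hV.isCycle.sum_eq_zero }
  refine thetaSupport_of_five_four (hU.isCircuit (Finset.card_pos.1 (by omega)) hU5.le) hV hU5 hV4
    ?_ fun x hx => ?_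
  · rw [Finset.union_inter_distrib_right, Finset.disjoint_iff_inter_eq_empty.1 (by simp [hgV, hgd]),
      Finset.empty_union, Finset.inter_eq_left.2 (Finset.erase_subset d V), hd3, hV4]
  · obtain h | rfl := hA x hx
    exacts [.inr h, .inl (by simp)]

end ThetaSupport

theorem pair_le_of_mem_of_ne {α : Type*} {s : Multiset α} {a b : α} (ha : a ∈ s) (hb : b ∈ s)
    (hab : a ≠ b) : {a, b} ≤ s :=
  (Multiset.cons_le_of_notMem (by simpa)).2 ⟨ha, Multiset.singleton_le.2 hb⟩

theorem nodup_cover {α : Type*} {F : Multiset (Finset α)}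
    (hF : ∀ C D, {C, D} ≤ F → Disjoint C D) : (cover F).Nodup := by
  induction F using Multiset.induction_on with
  | empty => simp
  | cons C F ih =>
    rw [cover_cons, Multiset.nodup_add]
    refine ⟨C.nodup, ih fun D D' h => hF D D' (h.trans (Multiset.le_cons_self F C)), ?_⟩
    rw [Multiset.disjoint_left]
    intro x hxC hxF
    obtain ⟨D, hD, hxD⟩ := mem_cover.1 hxF
    exact Finset.disjoint_left.1
      (hF C D (Multiset.cons_le_cons C (Multiset.singleton_le.2 hD))) hxC hxD

theorem le_of_nodup_of_add_two_nsmul_eq {α : Type*} {A B R S : Multiset α} (hA : A.Nodup)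
    (h : A + 2 • R = B + 2 • S) : A ≤ B := by
  classical
  rw [Multiset.le_iff_subset hA]
  intro x hx
  have hc := congrArg (Multiset.count x) h
  rw [Multiset.count_add, Multiset.count_add, Multiset.count_nsmul, Multiset.count_nsmul,
    Multiset.count_eq_one_of_mem hA hx] at hc
  rw [← Multiset.count_pos]
  omega

section Reduced

variable {G : Type*} [AddCommGroup G] {A : Multiset G} {F : Multiset (Finset G)} {R : Multiset G}

/-- A factorization of `A` into the circuits of `F` and the squares of the terms of `R` that has as
few circuits as its weight allows, while the weight two below it (truncated at `0`)
is not attained by `A`. -/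
structure IsReduced (A : Multiset G) (F : Multiset (Finset G)) (R : Multiset G) : Prop where
  isCircuit : ∀ C ∈ F, IsCircuit C
  cover_add_eq : cover F + 2 • R = A
  gap : ¬HasWeight A (weight F - 2)
  minimal : ∀ F' R', (∀ C ∈ F', IsCircuit C) → cover F' + 2 • R' = A → weight F' = weight F →
    F.card ≤ F'.card

theorem HasWeight.exists_isReduced {w : ℕ} (hw : HasWeight A w) (hgap : ¬HasWeight A (w - 2)) :
    ∃ F R, IsReduced A F R ∧ weight F = w := by
  obtain ⟨F, ⟨hF, ⟨R, hA⟩, rfl⟩, hmin⟩ := exists_minimalFor_of_wellFoundedLT _ Multiset.card hw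
  refine ⟨F, R, ⟨hF, hA, hgap, fun F' R' hF' hA' hw' => ?_⟩, rfl⟩
  by_contra! hlt
  exact hlt.not_ge (hmin ⟨hF', ⟨R', hA'⟩, hw'⟩ hlt.le)

namespace IsReduced

theorem mem_cases (h : IsReduced A F R) {x : G} (hx : x ∈ A) : (∃ C ∈ F, x ∈ C) ∨ x ∈ R := by
  rw [← h.cover_add_eq, Multiset.mem_add, mem_cover] at hx
  exact hx.imp_right Multiset.mem_of_mem_nsmul

theorem mem_of_mem_squares (h : IsReduced A F R) {x : G} (hx : x ∈ R) : x ∈ A := by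
  rw [← h.cover_add_eq]
  exact Multiset.mem_add.2 (.inr (Multiset.mem_nsmul.2 ⟨two_ne_zero, hx⟩))

theorem not_hasWeight_of_le (h : IsReduced A F R) {F₀ : Multiset (Finset G)} {R₀ : Multiset G}
    {v : ℕ} (hF : F₀ ≤ F) (hR : R₀ ≤ R) (hv : weight F₀ = v + 2) :
    ¬HasWeight (cover F₀ + 2 • R₀) v := by
  intro hw
  obtain ⟨F₁, rfl⟩ := Multiset.le_iff_exists_add.1 hF
  obtain ⟨R₁, rfl⟩ := Multiset.le_iff_exists_add.1 hR
  have h₁ : HasWeight (cover F₁) (weight F₁) :=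
    ⟨F₁, fun C hC => h.isCircuit C (Multiset.mem_add.2 (.inr hC)), ⟨0, by simp⟩, rfl⟩
  refine h.gap ?_
  rw [← h.cover_add_eq, cover_add, nsmul_add, weight_add]
  convert (hw.add h₁).add_two_nsmul R₁ using 1
  · abel
  · omega

variable {U V : Finset G}

theorem isCircuit_left (h : IsReduced A F R) (hUV : {U, V} ≤ F) : IsCircuit U :=
  h.isCircuit U (Multiset.mem_of_le hUV (by simp))

theorem isCircuit_right (h : IsReduced A F R) (hUV : {U, V} ≤ F) : IsCircuit V :=
  h.isCircuit V (Multiset.mem_of_le hUV (by simp))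

variable [Module (ZMod 2) G]

theorem not_hasWeight_pair (h : IsReduced A F R) (hUV : {U, V} ≤ F) {v : ℕ}
    (hv : U.card + V.card = v + 6) : ¬HasWeight (U.val + V.val) v := by
  have hU := (h.isCircuit_left hUV).three_le_card
  have hV := (h.isCircuit_right hUV).three_le_card
  have := h.not_hasWeight_of_le hUV (Multiset.zero_le R) (v := v)
    (by simp only [Multiset.insert_eq_cons, weight_cons, weight_singleton]; omega)
  simpa using this

theorem card_ne_three (h : IsReduced A F R) (hUU : {U, U} ≤ F) : U.card ≠ 3 := fun h3 =>
  h.not_hasWeight_pair hUU (v := 0) (by omega)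
    (two_nsmul U.val ▸ hasWeight_two_nsmul U.val)

variable [DecidableEq G]

theorem card_inter_ne (h : IsReduced A F R) (hUV : {U, V} ≤ F) (hne : U ≠ V)
    (h5 : (U ∆ V).card ≤ 5) : (U ∩ V).card ≠ 1 ∧ (U ∩ V).card ≠ 2 := by
  have hU := h.isCircuit_left hUV
  have hV := h.isCircuit_right hUV
  have hW := (hU.isCycle.symmDiff hV.isCycle).isCircuit
    (Finset.nonempty_iff_ne_empty.2 fun h => hne (symmDiff_eq_bot.1 h)) h5
  have hU3 := hU.three_le_card
  have hV3 := hV.three_le_card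
  have hW3 := hW.three_le_card
  have hc := card_symmDiff_add U V
  refine ⟨fun h1 => ?_, fun h2 => ?_⟩
  · obtain ⟨F₁, rfl⟩ := Multiset.le_iff_exists_add.1 hUV
    have := h.minimal ((U ∆ V) ::ₘ F₁) ((U ∩ V).val + R)
      (Multiset.forall_mem_cons.2 ⟨hW, fun C hC => h.isCircuit C (Multiset.mem_add.2 (.inr hC))⟩)
      (by
        rw [← h.cover_add_eq, cover_add, cover_cons, nsmul_add, Multiset.insert_eq_cons, cover_cons,
          cover_singleton, val_add_val]
        abel)
      (by simp only [Multiset.insert_eq_cons, weight_cons, weight_singleton, weight_add]; omega)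
    simp at this
  · refine h.not_hasWeight_pair hUV (v := (U ∆ V).card - 2) (by omega) ?_
    rw [val_add_val]
    exact hW.hasWeight.add_two_nsmul _

end IsReduced
end Reduced

namespace IsReduced

variable {A R : Multiset E4} {F : Multiset (Finset E4)} {U V : Finset E4}

theorem pair_cases (h : IsReduced A F R) (hUV : {U, V} ≤ F) (hne : U ≠ V) :
    (Disjoint U V ∧ U.card + V.card ≤ 8) ∨ ((U ∩ V).card = 3 ∧ U.card + V.card = 9) := by
  have hU := h.isCircuit_left hUV
  have hV := h.isCircuit_right hUV
  have hU3 := hU.three_le_card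
  have hV3 := hV.three_le_card
  have hU5 := hU.card_le_five
  have hV5 := hV.card_le_five
  have h10 : ¬(U.card = 5 ∧ V.card = 5) := fun ⟨hU5, hV5⟩ =>
    h.not_hasWeight_pair hUV (by omega) (hasWeight_five_add_five hU hV hU5 hV5 hne)
  have hcard := card_symmDiff_add U V
  have hcyc := hU.isCycle.symmDiff hV.isCycle
  have hW3 := hcyc.three_le_card
    (Finset.nonempty_iff_ne_empty.2 fun h => hne (symmDiff_eq_bot.1 h))
  by_cases hd : Disjoint U V
  · refine .inl ⟨hd, ?_⟩
    by_contra! h9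
    obtain ⟨h5, h4⟩ | ⟨h4, h5⟩ : U.card = 5 ∧ V.card = 4 ∨ U.card = 4 ∧ V.card = 5 := by omega
    · exact h.not_hasWeight_pair hUV (by omega) (hasWeight_five_add_four hU hV h5 h4 hd)
    · exact h.not_hasWeight_pair hUV (v := 3) (by omega)
        (add_comm V.val U.val ▸ hasWeight_five_add_four hV hU h5 h4 hd.symm)
  · right
    have hpos : 0 < (U ∩ V).card :=
      Finset.card_pos.2 (Finset.not_disjoint_iff_nonempty_inter.1 hd)
    by_cases h5 : (U ∆ V).card ≤ 5
    · have := h.card_inter_ne hUV hne h5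
      omega
    · refine absurd ?_ (h.not_hasWeight_pair hUV (v := (U ∆ V).card - 4) (by omega))
      rw [val_add_val]
      exact (hcyc.hasWeight_of_card_le_eight (by omega) (by omega)).add_two_nsmul _

theorem weight_le (h : IsReduced A F R) (hF : ∀ C D, {C, D} ≤ F → Disjoint C D) :
    weight F ≤ F.card + 2 ∨ weight F ≤ 2 * F.card := by
  by_cases h5 : ∃ U ∈ F, U.card = 5
  · obtain ⟨U, hU, hU5⟩ := h5
    obtain ⟨F₁, rfl⟩ := Multiset.exists_cons_of_mem hU
    have := weight_le_mul_card (F := F₁) (c := 1) fun C hC => by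
      have hle : {U, C} ≤ U ::ₘ F₁ := Multiset.cons_le_cons U (Multiset.singleton_le.2 hC)
      have hd := hF U C hle
      have hne : U ≠ C := fun hUC => by
        rw [← hUC, disjoint_self, Finset.bot_eq_empty] at hd
        simp [hd] at hU5
      obtain ⟨-, h8⟩ | ⟨h3, -⟩ := h.pair_cases hle hne
      · omega
      · simp [Finset.disjoint_iff_inter_eq_empty.1 hd] at h3
    rw [weight_cons, Multiset.card_cons]
    omega
  · push Not at h5
    refine .inr (weight_le_mul_card fun C hC => ?_)
    have := (h.isCircuit C hC).card_le_five
    have := h5 C hC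
    omega

theorem exists_not_disjoint (h : IsReduced A F R) (hlt : ∃ v < weight F, HasWeight A v) :
    ∃ C D, {C, D} ≤ F ∧ ¬Disjoint C D := by
  by_contra! hF
  have hnd := nodup_cover hF
  have h16 := Finset.card_le_univ (⟨cover F, hnd⟩ : Finset E4)
  rw [Finset.card_mk, card_cover h.isCircuit, show Fintype.card E4 = 16 by simp] at h16
  obtain ⟨v, hv, hAv⟩ := hlt
  have hv4 : v + 4 ≤ weight F := by
    have h₁ := hAv.mod_two
    have h₂ := HasWeight.mod_two ⟨F, h.isCircuit, ⟨R, h.cover_add_eq⟩, rfl⟩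
    have h₃ : v ≠ weight F - 2 := fun e => h.gap (e ▸ hAv)
    omega
  obtain ⟨F', hF', ⟨R', hA'⟩, rfl⟩ := hAv
  have hle := Multiset.card_le_card
    (le_of_nodup_of_add_two_nsmul_eq hnd (h.cover_add_eq.trans hA'.symm))
  rw [card_cover h.isCircuit, card_cover hF'] at hle
  have := card_le_weight hF'
  have := h.weight_le hF
  omega

theorem support_of_five_four (h : IsReduced A F R) (h0 : 0 ∉ A) (hUV : {U, V} ≤ F)
    (hU5 : U.card = 5) (hV4 : V.card = 4) : (U ∩ V).card = 3 ∧ ∀ x ∈ A, x ∈ U ∨ x ∈ V := by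
  have hUF := Multiset.mem_of_le hUV (by simp : U ∈ {U, V})
  have hVF := Multiset.mem_of_le hUV (by simp : V ∈ {U, V})
  have hU := h.isCircuit U hUF
  have hV := h.isCircuit V hVF
  have hi : (U ∩ V).card = 3 := by
    have := h.pair_cases hUV (by rintro rfl; omega)
    omega
  refine ⟨hi, fun x hx => ?_⟩
  by_contra! hne
  obtain ⟨C, hC, hxC⟩ | hxR := h.mem_cases hx
  · have hCU : C ≠ U := by rintro rfl; exact hne.1 hxC
    have hCV : C ≠ V := by rintro rfl; exact hne.2 hxC
    have hC3 := (h.isCircuit C hC).three_le_card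
    obtain ⟨hdU, hC3⟩ : Disjoint C U ∧ C.card = 3 := by
      obtain ⟨hdU, h8⟩ | ⟨hCU3, h9⟩ := h.pair_cases (pair_le_of_mem_of_ne hC hUF hCU) hCU
      · exact ⟨hdU, by omega⟩
      · obtain ⟨hdV, -⟩ | ⟨-, h9'⟩ := h.pair_cases (pair_le_of_mem_of_ne hC hVF hCV) hCV
        · have hle := Finset.card_le_card
            (Finset.union_subset (Finset.inter_subset_right (s₁ := C) (s₂ := U))
              (Finset.inter_subset_left (s₁ := U) (s₂ := V)))
          rw [Finset.card_union_of_disjoint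
            (hdV.mono Finset.inter_subset_left Finset.inter_subset_right)] at hle
          omega
        · omega
    have hdV : Disjoint C V := by
      obtain ⟨hdV, -⟩ | ⟨-, h9⟩ := h.pair_cases (pair_le_of_mem_of_ne hC hVF hCV) hCV
      · exact hdV
      · omega
    refine h.not_hasWeight_of_le (F₀ := C ::ₘ {U, V}) (v := 4) ?_ (Multiset.zero_le R) ?_ ?_
    · exact (Multiset.cons_le_of_notMem (by simp [hCU, hCV])).2 ⟨hC, hUV⟩
    · simp [hU5, hV4, hC3]
    · convert hasWeight_five_add_four_add_three hU hV (h.isCircuit C hC) hU5 hV4 hC3 hi hdU.symm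
        hdV.symm using 1
      simp [add_comm]
  · refine h.not_hasWeight_of_le hUV (Multiset.singleton_le.2 hxR) (v := 3) ?_ ?_
    · simp [hU5, hV4]
    · simpa using hasWeight_five_add_four_add_square hU hV hU5 hV4 hi hne.1 hne.2
        (ne_of_mem_of_not_mem hx h0)

theorem support_of_two_five (h : IsReduced A F R) (h0 : 0 ∉ A) (hUU : {U, U} ≤ F)
    (hU5 : U.card = 5) (h4 : ∀ V ∈ F, V.card ≠ 4) : ∀ x ∈ A, x ∈ U := by
  have hU := h.isCircuit_left hUU
  intro x hx
  by_contra hxU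
  obtain ⟨C, hC, hxC⟩ | hxR := h.mem_cases hx
  · have hCU : C ≠ U := by rintro rfl; exact hxU hxC
    have hC3 := (h.isCircuit C hC).three_le_card
    have := h4 C hC
    obtain ⟨hd, h8⟩ | ⟨-, h9⟩ := h.pair_cases
      (pair_le_of_mem_of_ne hC (Multiset.mem_of_le hUU (by simp)) hCU) hCU
    · refine h.not_hasWeight_of_le (F₀ := C ::ₘ {U, U}) (v := 5) ?_ (Multiset.zero_le R) ?_ ?_
      · exact (Multiset.cons_le_of_notMem (by simp [hCU])).2 ⟨hC, hUU⟩
      · simp [hU5, show C.card = 3 by omega]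
      · convert hasWeight_two_nsmul_five_add_three hU (h.isCircuit C hC) hU5 (by omega) hd.symm
          using 1
        simp [two_nsmul, add_comm]
    · omega
  · refine h.not_hasWeight_of_le hUU (Multiset.singleton_le.2 hxR) (v := 4) ?_ ?_
    · simp [hU5]
    · simpa [two_nsmul] using
        hasWeight_two_nsmul_five_add_square hU hU5 hxU (ne_of_mem_of_not_mem hx h0)

theorem eq_replicate_of_two_four (h : IsReduced A F R) (hVV : {V, V} ≤ F) (hV4 : V.card = 4)
    (h5 : ∀ U ∈ F, U.card ≠ 5) : F = Multiset.replicate F.card V := by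
  have hV := h.isCircuit_left hVV
  refine Multiset.eq_replicate_card.2 fun C hC => ?_
  by_contra hne
  have hC3 := (h.isCircuit C hC).three_le_card
  have := h5 C hC
  obtain ⟨hd, h8⟩ | ⟨-, h9⟩ := h.pair_cases
    (pair_le_of_mem_of_ne hC (Multiset.mem_of_le hVV (by simp)) hne) hne
  · refine h.not_hasWeight_of_le (F₀ := C ::ₘ {V, V}) (v := C.card) ?_ (Multiset.zero_le R) ?_ ?_
    · exact (Multiset.cons_le_of_notMem (by simp [hne])).2 ⟨hC, hVV⟩
    · simp only [Multiset.insert_eq_cons, weight_cons, weight_singleton, hV4]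
      omega
    · convert hasWeight_two_nsmul_four_add hV hV4 (h.isCircuit C hC) (by omega) hd.symm using 1
      simp [two_nsmul, add_comm]
  · omega

section TwoFour

variable (h : IsReduced A F R) (hVV : {V, V} ≤ F) (hV4 : V.card = 4)
include h hVV hV4

theorem exists_notMem_of_card_eq_three {T : Finset E4} (hT : IsCircuit T) (hT3 : T.card = 3) :
    ∃ x ∈ T, x ∉ V ∧ x ∉ R := by
  by_contra! hTA
  obtain ⟨Q, hQ⟩ := Multiset.le_iff_exists_add.1 <| (Multiset.le_iff_subset T.nodup).2
    fun x hx => Multiset.mem_add.2 (or_iff_not_imp_left.2 (hTA x hx))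
  refine h.not_hasWeight_of_le hVV le_rfl (v := 2) (by simp [hV4]) ?_
  have hTT := hT.hasWeight.add hT.hasWeight
  rw [hT3] at hTT
  convert hTT.add_two_nsmul Q using 1
  rw [← two_nsmul, ← nsmul_add, ← hQ]
  simp [two_nsmul]

theorem mem_or_mem_of_two_four (h5 : ∀ U ∈ F, U.card ≠ 5) {x : E4} (hx : x ∈ A) :
    x ∈ V ∨ x ∈ R :=
  (h.mem_cases hx).imp_left fun ⟨C, hC, hxC⟩ => by
    rw [h.eq_replicate_of_two_four hVV hV4 h5] at hC
    rwa [Multiset.eq_of_mem_replicate hC] at hxC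

theorem card_eq_four_of_two_four (h5 : ∀ U ∈ F, U.card ≠ 5) {C : Finset E4} (hC : IsCircuit C)
    (hCA : ∀ x ∈ C, x ∈ A) : C.card = 4 := by
  have hV := h.isCircuit_left hVV
  have hC3 := hC.three_le_card
  have hC5 := hC.card_le_five
  have not_three {T : Finset E4} (hT : IsCircuit T) (hTA : ∀ x ∈ T, x ∈ V ∨ x ∈ A) :
      T.card ≠ 3 := fun hT3 => by
    obtain ⟨x, hxT, hxV, hxR⟩ := h.exists_notMem_of_card_eq_three hVV hV4 hT hT3
    exact (hTA x hxT).elim hxV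
      fun hxA => (h.mem_or_mem_of_two_four hVV hV4 h5 hxA).elim hxV hxR
  have h3 := not_three hC fun x hx => .inr (hCA x hx)
  by_contra h4
  have hCne : ¬V ⊆ C := fun hVC => h4 (by
    rw [← hC.eq_of_subset hV.isCycle hV.nonempty hVC, hV4])
  obtain ⟨g, hgV, hgC⟩ := Finset.not_subset.1 hCne
  obtain ⟨P, Q, hPQ, rfl⟩ := hC.exists_isTheta (by omega) hgC
    (ne_of_mem_of_not_mem hgV hV.isCycle.zero_notMem)
  refine not_three hPQ.isCircuit_insert_left (fun x hx => ?_) hPQ.card_insert_left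
  obtain rfl | hxP := Finset.mem_insert.1 hx
  exacts [.inl hgV, .inr (hCA x (Finset.mem_union_left Q hxP))]

theorem thetaSupport_of_three_four (h0 : 0 ∉ A) (h5 : ∀ U ∈ F, U.card ≠ 5) (hF : 3 ≤ F.card) :
    ThetaSupport A := by
  have hV := h.isCircuit_left hVV
  have hA := fun x => h.mem_or_mem_of_two_four hVV hV4 h5 (x := x)
  have hR0 : ∀ x ∈ R, x ≠ 0 := fun x hx => ne_of_mem_of_not_mem (h.mem_of_mem_squares hx) h0
  by_cases hR : ∀ x ∈ R, x ∈ V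
  · obtain ⟨g, hg⟩ := hV.exists_forall_sum_ne hV4
    exact thetaSupport_of_four hV hV4 hg fun x hx => .inl ((hA x hx).elim id (hR x))
  push Not at hR
  obtain ⟨g, hgR, hgV⟩ := hR
  refine thetaSupport_of_four hV hV4 (hV.forall_sum_ne hV4 hgV (hR0 g hgR) fun S hS hS2 hSg => ?_)
    fun x hx => ?_
  · obtain ⟨hT, hT3⟩ := isCircuit_insert_sum (fun h => hV.isCycle.zero_notMem (hS h)) hS2
    obtain ⟨x, hxT, hxV, hxR⟩ := h.exists_notMem_of_card_eq_three hVV hV4 hT hT3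
    obtain rfl | hxS := Finset.mem_insert.1 hxT
    exacts [hxR (hSg ▸ hgR), hxV (hS hxS)]
  · by_contra! hne
    have hxR := (hA x hx).resolve_left hne.1
    obtain ⟨T, hTs, hT, hT3⟩ | hw := hV.exists_three_or_hasWeight hV4 hgV (hR0 g hgR) hne.1
      (hR0 x hxR) hne.2.symm
    · obtain ⟨y, hyT, hyV, hyR⟩ := h.exists_notMem_of_card_eq_three hVV hV4 hT hT3
      have := hTs hyT
      simp only [Finset.mem_union, Finset.mem_insert, Finset.mem_singleton, hyV, false_or] at this
      obtain rfl | rfl := this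
      exacts [hyR hgR, hyR hxR]
    · refine h.not_hasWeight_of_le (F₀ := Multiset.replicate 3 V) (v := 4) ?_
        (pair_le_of_mem_of_ne hgR hxR hne.2.symm) ?_ ?_
      · rw [h.eq_replicate_of_two_four hVV hV4 h5]
        exact (Multiset.replicate_le_replicate V).2 hF
      · rw [weight_replicate, hV4]
      · convert hw.add_two_nsmul V.val using 1
        rw [cover_replicate, show (3 : ℕ) = 1 + 2 from rfl, add_nsmul, one_nsmul]
        abel

end TwoFour

theorem thetaSupport_of_five_four (h : IsReduced A F R) (h0 : 0 ∉ A) (hU : U ∈ F) (hV : V ∈ F)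
    (hU5 : U.card = 5) (hV4 : V.card = 4) : ThetaSupport A := by
  obtain ⟨hUV, hA⟩ := h.support_of_five_four h0
    (pair_le_of_mem_of_ne hU hV (by rintro rfl; omega)) hU5 hV4
  exact SetsOfLengths.thetaSupport_of_five_four (h.isCircuit U hU) (h.isCircuit V hV) hU5 hV4 hUV
    hA

end IsReduced

theorem thetaSupport_or_eq_two_nsmul_of_gap {A : Multiset E4} {w : ℕ} (h0 : 0 ∉ A)
    (hw : HasWeight A w) (hgap : ¬HasWeight A (w - 2)) (hlt : ∃ v < w, HasWeight A v) :
    ThetaSupport A ∨ (w = 4 ∧ (∃ Q, A = 2 • Q) ∧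
      ∀ C, IsCircuit C → (∀ x ∈ C, x ∈ A) → C.card = 4) := by
  obtain ⟨F, R, h, rfl⟩ := hw.exists_isReduced hgap
  obtain ⟨C, D, hCD, hd⟩ := h.exists_not_disjoint hlt
  have hC := Multiset.mem_of_le hCD (by simp : C ∈ {C, D})
  have hD := Multiset.mem_of_le hCD (by simp : D ∈ {C, D})
  have hC3 := (h.isCircuit C hC).three_le_card
  have hC5 := (h.isCircuit C hC).card_le_five
  have hD5 := (h.isCircuit D hD).card_le_five
  by_cases hex : (∃ U ∈ F, U.card = 5) ∧ ∃ V ∈ F, V.card = 4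
  · obtain ⟨⟨U, hU, hU5⟩, V, hV, hV4⟩ := hex
    exact .inl (h.thetaSupport_of_five_four h0 hU hV hU5 hV4)
  obtain rfl | hne := eq_or_ne C D
  · have hne3 := h.card_ne_three hCD
    obtain h5 | h4 : C.card = 5 ∨ C.card = 4 := by omega
    · exact .inl (thetaSupport_of_five (h.isCircuit C hC) h5
        (h.support_of_two_five h0 hCD h5 fun V hV hV4 => hex ⟨⟨C, hC, h5⟩, V, hV, hV4⟩))
    have hF5 : ∀ U ∈ F, U.card ≠ 5 := fun U hU hU5 => hex ⟨⟨U, hU, hU5⟩, C, hC, h4⟩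
    have hF2 : 2 ≤ F.card := by simpa using Multiset.card_le_card hCD
    obtain hF3 | hF2 := hF2.lt_or_eq
    · exact .inl (h.thetaSupport_of_three_four hCD h4 h0 hF5 hF3)
    · have hF := h.eq_replicate_of_two_four hCD h4 hF5
      rw [← hF2] at hF
      refine .inr ⟨by rw [hF, weight_replicate, h4], ⟨C.val + R, ?_⟩,
        fun E hE hEA => h.card_eq_four_of_two_four hCD h4 hF5 hE hEA⟩
      rw [← h.cover_add_eq, hF, cover_replicate, nsmul_add]
  · obtain ⟨hd', -⟩ | ⟨-, h9⟩ := h.pair_cases hCD hne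
    · exact absurd hd' hd
    · obtain ⟨h5, h4⟩ | ⟨h4, h5⟩ : C.card = 5 ∧ D.card = 4 ∨ C.card = 4 ∧ D.card = 5 := by omega
      exacts [(hex ⟨⟨C, hC, h5⟩, D, hD, h4⟩).elim, (hex ⟨⟨D, hD, h5⟩, C, hC, h4⟩).elim]

section Families

open scoped Pointwise

theorem mem_singleton_add {a n : ℕ} {S : Set ℕ} : n ∈ ({a} : Set ℕ) + S ↔ ∃ s ∈ S, n = a + s := by
  simp only [Set.singleton_add, Set.mem_image, eq_comm]

theorem mem_singleton_add_Icc {a b c n : ℕ} :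
    n ∈ ({a} : Set ℕ) + Set.Icc b c ↔ a + b ≤ n ∧ n ≤ a + c := by
  rw [mem_singleton_add]
  refine ⟨?_, fun h => ⟨n - a, ⟨by omega, by omega⟩, by omega⟩⟩
  rintro ⟨s, ⟨hb, hc⟩, rfl⟩
  omega

theorem mem_dilate_Icc {d k n : ℕ} : n ∈ dilate d (Set.Icc 0 k) ↔ ∃ i ≤ k, n = d * i := by
  simp [dilate, eq_comm]

theorem mem_singleton_add_dilate_Icc {a d k n : ℕ} :
    n ∈ ({a} : Set ℕ) + dilate d (Set.Icc 0 k) ↔ ∃ i ≤ k, n = a + d * i := by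
  rw [mem_singleton_add]
  simp only [mem_dilate_Icc]
  refine ⟨?_, fun ⟨i, hi, h⟩ => ⟨_, ⟨i, hi, rfl⟩, h⟩⟩
  rintro ⟨_, ⟨i, hi, rfl⟩, h⟩
  exact ⟨i, hi, h⟩

theorem mem_singleton_add_triple_add_dilate_Icc {a b c k n : ℕ} :
    n ∈ ({a} : Set ℕ) + {0, b, c} + dilate 3 (Set.Icc 0 k) ↔
      ∃ i ≤ k, n = a + 3 * i ∨ n = a + b + 3 * i ∨ n = a + c + 3 * i := by
  rw [Set.mem_add]
  simp only [mem_singleton_add, mem_dilate_Icc, Set.mem_insert_iff, Set.mem_singleton_iff]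
  constructor
  · rintro ⟨_, ⟨s, rfl | rfl | rfl, rfl⟩, _, ⟨i, hi, rfl⟩, rfl⟩
    exacts [⟨i, hi, .inl rfl⟩, ⟨i, hi, .inr (.inl rfl)⟩, ⟨i, hi, .inr (.inr rfl)⟩]
  · rintro ⟨i, hi, rfl | rfl | rfl⟩
    exacts [⟨a + 0, ⟨0, .inl rfl, rfl⟩, _, ⟨i, hi, rfl⟩, rfl⟩,
      ⟨a + b, ⟨b, .inr (.inl rfl), rfl⟩, _, ⟨i, hi, rfl⟩, rfl⟩,
      ⟨a + c, ⟨c, .inr (.inr rfl), rfl⟩, _, ⟨i, hi, rfl⟩, rfl⟩]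

theorem natCeil_div_three (k : ℕ) : ⌈(k : ℚ) / 3⌉₊ = (k + 2) / 3 := by
  refine eq_of_forall_ge_iff fun n => ?_
  rw [Nat.ceil_le, div_le_iff₀ three_pos]
  norm_cast
  omega

variable {L : Set ℕ}

theorem mem_family1_iff : L ∈ family1 ↔ ∃ m, ∀ n, n ∈ L ↔ n = m := by
  simp only [family1, Set.mem_ofPred_eq, Set.ext_iff, Set.mem_singleton_iff]

theorem mem_family2_iff :
    L ∈ family2 ↔ ∃ m k, 2 * k ≤ m ∧ ∀ n, n ∈ L ↔ ∃ i ≤ k, n = m + 3 * i := by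
  simp only [family2, Set.mem_ofPred_eq, Set.ext_iff, mem_singleton_add_dilate_Icc]
  refine ⟨fun ⟨y, k, h⟩ => ⟨y + 2 * k, k, by omega, h⟩, fun ⟨m, k, hm, h⟩ => ?_⟩
  exact ⟨m - 2 * k, k, by rwa [Nat.sub_add_cancel hm]⟩

theorem mem_family4_iff :
    L ∈ family4 ↔ ∃ m k, 2 * k ≤ m ∧ ∀ n, n ∈ L ↔ ∃ i ≤ k, n = m + 2 * i := by
  simp only [family4, Set.mem_ofPred_eq, Set.ext_iff, mem_singleton_add_dilate_Icc]
  refine ⟨fun ⟨y, k, h⟩ => ⟨y + 2 * k, k, by omega, h⟩, fun ⟨m, k, hm, h⟩ => ?_⟩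
  exact ⟨m - 2 * k, k, by rwa [Nat.sub_add_cancel hm]⟩

/-- The common description of `family3` and `family3'`: intervals `[m, m + k]` with `k ≥ 1` that are
far enough to the right. -/
def IsLengthInterval (L : Set ℕ) : Prop :=
  ∃ m k, 1 ≤ k ∧ 2 * k ≤ 3 * m ∧ (k = 1 → 2 ≤ m) ∧ (k = 3 → 3 ≤ m) ∧
    ∀ n, n ∈ L ↔ m ≤ n ∧ n ≤ m + k

theorem isLeast_add_le_iff {k m : ℕ} :
    IsLeast {n : ℕ | (n : ℚ) + k ≤ 5 * n / 2} m ↔ m = (2 * k + 2) / 3 := by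
  have hset : {n : ℕ | (n : ℚ) + k ≤ 5 * n / 2} = Set.Ici ((2 * k + 2) / 3) := by
    ext n
    rw [Set.mem_ofPred_eq, le_div_iff₀ two_pos, Set.mem_Ici]
    norm_cast
    omega
  rw [hset]
  exact ⟨fun h => h.unique isLeast_Ici, fun h => h ▸ isLeast_Ici⟩

theorem mem_family3_iff : L ∈ family3 ↔ IsLengthInterval L := by
  simp only [family3, Set.mem_union, Set.mem_ofPred_eq, isLeast_add_le_iff, Set.ext_iff,
    mem_singleton_add_Icc, IsLengthInterval]
  constructor
  · rintro (⟨y, h | h | h | h | h⟩ | ⟨y, k, m, hk, rfl, h⟩)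
    · exact ⟨y + 2, 1, by omega, by omega, by omega, by omega, h⟩
    · exact ⟨y + 2, 2, by omega, by omega, by omega, by omega, h⟩
    · exact ⟨y + 3, 3, by omega, by omega, by omega, by omega, h⟩
    · exact ⟨y + 3, 4, by omega, by omega, by omega, by omega, h⟩
    · exact ⟨y + 4, 5, by omega, by omega, by omega, by omega, h⟩
    · exact ⟨y + (2 * k + 2) / 3, k, by omega, by omega, by omega, by omega,
        fun n => (h n).trans (by omega)⟩
  · rintro ⟨m, k, hk, hm, hk1, hk3, h⟩
    by_cases hk6 : 6 ≤ k
    · exact .inr ⟨m - (2 * k + 2) / 3, k, _, hk6, rfl, fun n => (h n).trans (by omega)⟩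
    obtain rfl | rfl | rfl | rfl | rfl : k = 1 ∨ k = 2 ∨ k = 3 ∨ k = 4 ∨ k = 5 := by omega
    · exact .inl ⟨m - 2, .inl fun n => (h n).trans (by omega)⟩
    · exact .inl ⟨m - 2, .inr <| .inl fun n => (h n).trans (by omega)⟩
    · exact .inl ⟨m - 3, .inr <| .inr <| .inl fun n => (h n).trans (by omega)⟩
    · exact .inl ⟨m - 3, .inr <| .inr <| .inr <| .inl fun n => (h n).trans (by omega)⟩
    · exact .inl ⟨m - 4, .inr <| .inr <| .inr <| .inr fun n => (h n).trans (by omega)⟩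

theorem mem_family3'_iff : L ∈ family3' ↔ IsLengthInterval L := by
  have hceil (k : ℕ) : ⌈(2 * k : ℚ) / 3⌉₊ = (2 * k + 2) / 3 := by
    exact_mod_cast natCeil_div_three (2 * k)
  simp only [family3', Set.mem_union, Set.mem_ofPred_eq, hceil, Set.ext_iff,
    mem_singleton_add_Icc, IsLengthInterval]
  constructor
  · rintro (⟨y, k, hk, hk1, hk3, h⟩ | ⟨y, h | h⟩)
    · exact ⟨y + (2 * k + 2) / 3, k, by omega, by omega, by omega, by omega, h⟩
    · exact ⟨y + 3, 3, by omega, by omega, by omega, by omega, h⟩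
    · exact ⟨y + 2, 1, by omega, by omega, by omega, by omega, h⟩
  · rintro ⟨m, k, hk, hm, hk1, hk3, h⟩
    obtain rfl | rfl | hk' : k = 1 ∨ k = 3 ∨ k ≠ 1 ∧ k ≠ 3 := by omega
    · exact .inr ⟨m - 2, .inr fun n => (h n).trans (by omega)⟩
    · exact .inr ⟨m - 3, .inl fun n => (h n).trans (by omega)⟩
    · exact .inl ⟨m - (2 * k + 2) / 3, k, hk, hk'.1, hk'.2, fun n => (h n).trans (by omega)⟩

theorem mem_family5_iff : L ∈ family5 ↔ ∃ m k, 1 ≤ k ∧ k + 2 ≤ m ∧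
    ∀ n, n ∈ L ↔ (m ≤ n ∧ n ≤ m + k) ∨ n = m + k + 2 := by
  simp only [family5, Set.mem_ofPred_eq, Set.ext_iff, Set.add_union, Set.mem_union,
    mem_singleton_add_Icc, Set.singleton_add_singleton, Set.mem_singleton_iff]
  refine ⟨fun ⟨y, k, hk, h⟩ => ⟨y + k + 2, k, hk, by omega, h⟩, fun ⟨m, k, hk, hm, h⟩ => ?_⟩
  exact ⟨m - (k + 2), k, hk, fun n => (h n).trans (by omega)⟩

theorem mem_family6_iff : L ∈ family6 ↔ ∃ m k, (5 ≤ k ∨ k = 3) ∧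
    2 * ((k + 2) / 3) + 2 ≤ m ∧ ∀ n, n ∈ L ↔ n = m ∨ (m + 2 ≤ n ∧ n ≤ m + k + 2) := by
  simp only [family6, Set.mem_ofPred_eq, Set.ext_iff, Set.add_union, Set.mem_union,
    mem_singleton_add_Icc, Set.singleton_add_singleton, Set.mem_singleton_iff, natCeil_div_three]
  refine ⟨fun ⟨y, k, hk, h⟩ => ⟨y + 2 * ((k + 2) / 3) + 2, k, hk, by omega, h⟩,
    fun ⟨m, k, hk, hm, h⟩ => ?_⟩
  exact ⟨m - (2 * ((k + 2) / 3) + 2), k, hk, fun n => (h n).trans (by omega)⟩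

theorem mem_family7_iff : L ∈ family7 ↔
    (∃ m k, 2 * k + 3 ≤ m ∧ ∀ n, n ∈ L ↔
      ∃ i ≤ k, n = m + 3 * i ∨ n = m + 1 + 3 * i ∨ n = m + 3 + 3 * i) ∨
    ∃ m k, 2 * k + 4 ≤ m ∧ ∀ n, n ∈ L ↔
      (∃ i ≤ k, n = m + 3 * i ∨ n = m + 1 + 3 * i ∨ n = m + 3 + 3 * i) ∨ n = m + 3 * k + 4 := by
  simp only [family7, Set.mem_union, Set.mem_ofPred_eq, Set.ext_iff,
    mem_singleton_add_triple_add_dilate_Icc, Set.mem_singleton_iff]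
  have hend (y k : ℕ) : y + 2 * k + 4 + 3 * k + 4 = y + 5 * k + 8 := by ring
  refine or_congr ⟨fun ⟨y, k, h⟩ => ⟨y + 2 * k + 3, k, by omega, h⟩, fun ⟨m, k, hm, h⟩ => ?_⟩
    ⟨fun ⟨y, k, h⟩ => ⟨y + 2 * k + 4, k, by omega, by rwa [hend]⟩, fun ⟨m, k, hm, h⟩ => ?_⟩
  · obtain ⟨y, rfl⟩ := Nat.exists_eq_add_of_le' hm
    exact ⟨y, k, h⟩
  · obtain ⟨y, rfl⟩ := Nat.exists_eq_add_of_le' hm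
    exact ⟨y, k, by rwa [← hend]⟩

theorem mem_family8_iff : L ∈ family8 ↔
    (∃ m k, 2 * k + 3 ≤ m ∧ ∀ n, n ∈ L ↔
      ∃ i ≤ k, n = m + 3 * i ∨ n = m + 2 + 3 * i ∨ n = m + 3 + 3 * i) ∨
    ∃ m k, 2 * k + 4 ≤ m ∧ ∀ n, n ∈ L ↔
      (∃ i ≤ k, n = m + 3 * i ∨ n = m + 2 + 3 * i ∨ n = m + 3 + 3 * i) ∨ n = m + 3 * k + 5 := by
  simp only [family8, Set.mem_union, Set.mem_ofPred_eq, Set.ext_iff,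
    mem_singleton_add_triple_add_dilate_Icc, Set.mem_singleton_iff]
  have hend (y k : ℕ) : y + 2 * k + 4 + 3 * k + 5 = y + 5 * k + 9 := by ring
  refine or_congr ⟨fun ⟨y, k, h⟩ => ⟨y + 2 * k + 3, k, by omega, h⟩, fun ⟨m, k, hm, h⟩ => ?_⟩
    ⟨fun ⟨y, k, h⟩ => ⟨y + 2 * k + 4, k, by omega, by rwa [hend]⟩, fun ⟨m, k, hm, h⟩ => ?_⟩
  · obtain ⟨y, rfl⟩ := Nat.exists_eq_add_of_le' hm
    exact ⟨y, k, h⟩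
  · obtain ⟨y, rfl⟩ := Nat.exists_eq_add_of_le' hm
    exact ⟨y, k, by rwa [← hend]⟩

end Families

section ThetaShapes

variable {x y z m n N : ℕ}

theorem mem_lengthSet_theta : n ∈ lengthSet (ThetaWeight x y z) N ↔
    ∃ p q, p ≤ x ∧ p % 2 = x % 2 ∧ q ≤ y ∧ q % 2 = y % 2 ∧ p ≤ q + z ∧ q ≤ p + z ∧
      2 * n + p + 2 * q = N := by
  constructor
  · rintro ⟨w, ⟨p, q, h⟩, hw⟩
    exact ⟨p, q, by omega⟩
  · rintro ⟨p, q, h⟩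
    exact ⟨p + 2 * q, ⟨p, q, by omega⟩, by omega⟩

theorem mem_lengthSet_theta_zero (hxy : x % 2 = y % 2) (hN : N = 2 * m + 3 * min x y) :
    n ∈ lengthSet (ThetaWeight x y 0) N ↔ ∃ i ≤ min x y / 2, n = m + 3 * i := by
  rw [mem_lengthSet_theta]
  constructor
  · rintro ⟨p, q, h⟩
    exact ⟨(min x y - p) / 2, by omega⟩
  · rintro ⟨i, h⟩
    exact ⟨min x y - 2 * i, min x y - 2 * i, by omega⟩

theorem mem_lengthSet_theta_left_le_one (hx : x ≤ 1) (hxz : x ≤ z) (hxyz : (x + y + z) % 2 = 0)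
    (hN : N = 2 * m + x + 2 * min y (x + z)) :
    n ∈ lengthSet (ThetaWeight x y z) N ↔ ∃ i ≤ min y (x + z) / 2, n = m + 2 * i := by
  rw [mem_lengthSet_theta]
  constructor
  · rintro ⟨p, q, h⟩
    exact ⟨(min y (x + z) - q) / 2, by omega⟩
  · rintro ⟨i, h⟩
    exact ⟨x, min y (x + z) - 2 * i, by omega⟩

theorem mem_lengthSet_theta_right_le_one (hy : y ≤ 1) (hyz : y ≤ z) (hxyz : (x + y + z) % 2 = 0)
    (hN : N = 2 * m + 2 * y + min x (y + z)) :
    n ∈ lengthSet (ThetaWeight x y z) N ↔ m ≤ n ∧ n ≤ m + min x (y + z) / 2 := by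
  rw [mem_lengthSet_theta]
  constructor
  · rintro ⟨p, q, h⟩
    omega
  · intro h
    exact ⟨min x (y + z) - 2 * (n - m), y, by omega⟩

section One

variable {i : ℕ}

/-! With a single copy of the chord the parities of `x` and `y` differ, so the multiplicities `p`
and `q` of a decomposition are consecutive numbers. -/

theorem mem_lengthSet_theta_even_lt (hy : 2 * i + 2 < y) (hy1 : y % 2 = 1)
    (hN : N = 2 * m + 6 * i + 8) :
    n ∈ lengthSet (ThetaWeight (2 * i + 2) y 1) N ↔
      ∃ j ≤ i, n = m + 3 * j ∨ n = m + 2 + 3 * j ∨ n = m + 3 + 3 * j := by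
  rw [mem_lengthSet_theta]
  constructor
  · rintro ⟨p, q, h⟩
    by_cases hp : p = 0
    · exact ⟨i, by omega⟩
    · exact ⟨(2 * i + 2 - p) / 2, by omega⟩
  · rintro ⟨j, hj, h | h | h⟩
    · exact ⟨2 * i + 2 - 2 * j, 2 * i + 3 - 2 * j, by omega⟩
    · exact ⟨2 * i + 2 - 2 * j, 2 * i + 1 - 2 * j, by omega⟩
    · exact ⟨2 * i - 2 * j, 2 * i + 1 - 2 * j, by omega⟩

theorem mem_lengthSet_theta_odd_lt (hy : 2 * i + 3 < y) (hy0 : y % 2 = 0)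
    (hN : N = 2 * m + 6 * i + 11) :
    n ∈ lengthSet (ThetaWeight (2 * i + 3) y 1) N ↔
      (∃ j ≤ i, n = m + 3 * j ∨ n = m + 2 + 3 * j ∨ n = m + 3 + 3 * j) ∨ n = m + 3 * i + 5 := by
  rw [mem_lengthSet_theta]
  constructor
  · rintro ⟨p, q, h⟩
    by_cases hq : q = 0
    · exact .inr (by omega)
    by_cases hp : p = 1
    · exact .inl ⟨i, by omega⟩
    · exact .inl ⟨(2 * i + 3 - p) / 2, by omega⟩
  · rintro (⟨j, hj, h | h | h⟩ | h)
    · exact ⟨2 * i + 3 - 2 * j, 2 * i + 4 - 2 * j, by omega⟩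
    · exact ⟨2 * i + 3 - 2 * j, 2 * i + 2 - 2 * j, by omega⟩
    · exact ⟨2 * i + 1 - 2 * j, 2 * i + 2 - 2 * j, by omega⟩
    · exact ⟨1, 0, by omega⟩

theorem mem_lengthSet_theta_odd_gt (hx : 2 * i + 2 < x) (hx1 : x % 2 = 1)
    (hN : N = 2 * m + 6 * i + 7) :
    n ∈ lengthSet (ThetaWeight x (2 * i + 2) 1) N ↔
      ∃ j ≤ i, n = m + 3 * j ∨ n = m + 1 + 3 * j ∨ n = m + 3 + 3 * j := by
  rw [mem_lengthSet_theta]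
  constructor
  · rintro ⟨p, q, h⟩
    by_cases hq : q = 0
    · exact ⟨i, by omega⟩
    · exact ⟨(2 * i + 2 - q) / 2, by omega⟩
  · rintro ⟨j, hj, h | h | h⟩
    · exact ⟨2 * i + 3 - 2 * j, 2 * i + 2 - 2 * j, by omega⟩
    · exact ⟨2 * i + 1 - 2 * j, 2 * i + 2 - 2 * j, by omega⟩
    · exact ⟨2 * i + 1 - 2 * j, 2 * i - 2 * j, by omega⟩

theorem mem_lengthSet_theta_even_gt (hx : 2 * i + 3 < x) (hx0 : x % 2 = 0)
    (hN : N = 2 * m + 6 * i + 10) :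
    n ∈ lengthSet (ThetaWeight x (2 * i + 3) 1) N ↔
      (∃ j ≤ i, n = m + 3 * j ∨ n = m + 1 + 3 * j ∨ n = m + 3 + 3 * j) ∨ n = m + 3 * i + 4 := by
  rw [mem_lengthSet_theta]
  constructor
  · rintro ⟨p, q, h⟩
    by_cases hp : p = 0
    · exact .inr (by omega)
    by_cases hq : q = 1
    · exact .inl ⟨i, by omega⟩
    · exact .inl ⟨(2 * i + 3 - q) / 2, by omega⟩
  · rintro (⟨j, hj, h | h | h⟩ | h)
    · exact ⟨2 * i + 4 - 2 * j, 2 * i + 3 - 2 * j, by omega⟩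
    · exact ⟨2 * i + 2 - 2 * j, 2 * i + 3 - 2 * j, by omega⟩
    · exact ⟨2 * i + 2 - 2 * j, 2 * i + 1 - 2 * j, by omega⟩
    · exact ⟨0, 1, by omega⟩

end One

theorem ThetaWeight.sub_two (hx : 2 ≤ x) (hz : 2 ≤ z) (hxyz : (x + y + z) % 2 = 0) {w : ℕ}
    (hw : ThetaWeight x y z w) (hmin : x % 2 + 2 * (y % 2) < w) (hmax : w ≠ 3 * x + 2 * z) :
    ThetaWeight x y z (w - 2) := by
  obtain ⟨p, q, h⟩ := hw
  by_cases hp : 2 ≤ p ∧ q + 2 ≤ p + z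
  · exact ⟨p - 2, q, by omega⟩
  · exact ⟨p + 2, q - 2, by omega⟩

theorem of_forall_sub_two {W : ℕ → Prop} {a c : ℕ} (hc : W c)
    (hstep : ∀ w, W w → a < w → w ≤ c → W (w - 2)) {w : ℕ} (haw : a ≤ w) (hwc : w ≤ c)
    (hpar : w % 2 = c % 2) : W w := by
  obtain ⟨j, hj⟩ : ∃ j, c = w + 2 * j := ⟨(c - w) / 2, by omega⟩
  induction j generalizing w with
  | zero => rwa [← show c = w from hj]
  | succ j ih =>
    exact hstep (w + 2) (ih (by omega) (by omega) (by omega) (by omega)) (by omega) (by omega)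

theorem mem_lengthSet_theta_large (hx : 2 ≤ x) (hz : 2 ≤ z) (hxyz : (x + y + z) % 2 = 0)
    (hy : x + z ≤ y) {k : ℕ} (hk : 2 * k + 4 + x % 2 + 2 * (y % 2) = 3 * x + 2 * z)
    (hN : N = 2 * m + 3 * x + 2 * z) :
    n ∈ lengthSet (ThetaWeight x y z) N ↔ n = m ∨ (m + 2 ≤ n ∧ n ≤ m + k + 2) := by
  constructor
  · rw [mem_lengthSet_theta]
    rintro ⟨p, q, h⟩
    by_cases hp : p = x
    · subst hp
      by_cases hq : q = p + z <;> omega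
    · omega
  · rintro (rfl | h)
    · exact mem_lengthSet_theta.2 ⟨x, x + z, by omega⟩
    have htop : ThetaWeight x y z (3 * x + 2 * z - 4) := ⟨x, x + z - 2, by omega⟩
    refine ⟨N - 2 * n, of_forall_sub_two (a := x % 2 + 2 * (y % 2)) htop (fun w hw haw _ => ?_)
      (by omega) (by omega) (by omega), by omega⟩
    exact hw.sub_two hx hz hxyz haw (by omega)

theorem le_or_eq_three_of_theta_large (hx : 2 ≤ x) (hz : 2 ≤ z) (hxyz : (x + y + z) % 2 = 0)
    {k : ℕ} (hk : 2 * k + 4 + x % 2 + 2 * (y % 2) = 3 * x + 2 * z) :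
    (5 ≤ k ∨ k = 3) ∧ 2 * ((k + 2) / 3) + 2 ≤ x + z := by
  obtain ⟨a, rfl | rfl⟩ := Nat.even_or_odd' x <;> obtain ⟨b, rfl | rfl⟩ := Nat.even_or_odd' z <;>
    obtain ⟨c, rfl | rfl⟩ := Nat.even_or_odd' y <;> omega

end ThetaShapes

section Classification

/-- The set systems on the right-hand side of the classification. -/
def families : Set (Set ℕ) :=
  family1 ∪ family2 ∪ family3 ∪ family4 ∪ family5 ∪ family6 ∪ family7 ∪ family8

theorem mem_families_iff {L : Set ℕ} : L ∈ families ↔ L ∈ family1 ∨ L ∈ family2 ∨ L ∈ family3 ∨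
    L ∈ family4 ∨ L ∈ family5 ∨ L ∈ family6 ∨ L ∈ family7 ∨ L ∈ family8 := by
  simp only [families, Set.mem_union, or_assoc]

variable {x y z N : ℕ}

theorem lengthSet_theta_zero_mem_family2 (hxy : x % 2 = y % 2) (hN : N % 2 = x % 2)
    (hle : 2 * x + 3 * y ≤ N) : lengthSet (ThetaWeight x y 0) N ∈ family2 :=
  mem_family2_iff.2 ⟨(N - 3 * min x y) / 2, min x y / 2, by omega,
    fun _ => mem_lengthSet_theta_zero hxy (by omega)⟩

theorem lengthSet_theta_mem_family4 (hx : x ≤ 1) (hxz : x ≤ z) (hxyz : (x + y + z) % 2 = 0)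
    (hN : N % 2 = x % 2) (hle : 2 * x + 3 * y + z ≤ N) :
    lengthSet (ThetaWeight x y z) N ∈ family4 :=
  mem_family4_iff.2 ⟨(N - x - 2 * min y (x + z)) / 2, min y (x + z) / 2, by omega,
    fun _ => mem_lengthSet_theta_left_le_one hx hxz hxyz (by omega)⟩

theorem lengthSet_theta_mem_family6 (hx : 2 ≤ x) (hz : 2 ≤ z) (hxyz : (x + y + z) % 2 = 0)
    (hy : x + z ≤ y) (hN : N % 2 = x % 2) (hle : 2 * x + 3 * y + z ≤ N) :
    lengthSet (ThetaWeight x y z) N ∈ family6 := by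
  obtain ⟨k, hk⟩ : ∃ k, 2 * k + 4 + x % 2 + 2 * (y % 2) = 3 * x + 2 * z :=
    ⟨(3 * x + 2 * z - 4 - x % 2 - 2 * (y % 2)) / 2, by omega⟩
  obtain ⟨h3, h2⟩ := le_or_eq_three_of_theta_large hx hz hxyz hk
  exact mem_family6_iff.2 ⟨(N - 3 * x - 2 * z) / 2, k, h3, by omega,
    fun _ => mem_lengthSet_theta_large hx hz hxyz hy hk (by omega)⟩

theorem lengthSet_theta_one_mem_family8 (hx : 2 ≤ x) (hxy : x < y) (hxy1 : (x + y) % 2 = 1)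
    (hN : N % 2 = x % 2) (hle : 2 * x + 3 * y + 1 ≤ N) :
    lengthSet (ThetaWeight x y 1) N ∈ family8 := by
  rw [mem_family8_iff]
  rcases Nat.mod_two_eq_zero_or_one x with h | h
  · obtain ⟨i, rfl⟩ : ∃ i, x = 2 * i + 2 := ⟨(x - 2) / 2, by omega⟩
    exact .inl ⟨(N - 6 * i - 8) / 2, i, by omega,
      fun _ => mem_lengthSet_theta_even_lt hxy (by omega) (by omega)⟩
  · obtain ⟨i, rfl⟩ : ∃ i, x = 2 * i + 3 := ⟨(x - 3) / 2, by omega⟩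
    exact .inr ⟨(N - 6 * i - 11) / 2, i, by omega,
      fun _ => mem_lengthSet_theta_odd_lt hxy (by omega) (by omega)⟩

theorem lengthSet_theta_one_mem_family7 (hy : 2 ≤ y) (hyx : y < x) (hxy1 : (x + y) % 2 = 1)
    (hN : N % 2 = x % 2) (hle : 2 * x + 3 * y + 1 ≤ N) :
    lengthSet (ThetaWeight x y 1) N ∈ family7 := by
  rw [mem_family7_iff]
  rcases Nat.mod_two_eq_zero_or_one y with h | h
  · obtain ⟨i, rfl⟩ : ∃ i, y = 2 * i + 2 := ⟨(y - 2) / 2, by omega⟩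
    exact .inl ⟨(N - 6 * i - 7) / 2, i, by omega,
      fun _ => mem_lengthSet_theta_odd_gt hyx (by omega) (by omega)⟩
  · obtain ⟨i, rfl⟩ : ∃ i, y = 2 * i + 3 := ⟨(y - 3) / 2, by omega⟩
    exact .inr ⟨(N - 6 * i - 10) / 2, i, by omega,
      fun _ => mem_lengthSet_theta_even_gt hyx (by omega) (by omega)⟩

theorem lengthSet_theta_one_mem_families_of_le_one (hx : 2 ≤ x) (hy : y ≤ 1)
    (hxy1 : (x + y) % 2 = 1) (hN : N % 2 = x % 2) (hle : 2 * x + 3 * y + 1 ≤ N) :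
    lengthSet (ThetaWeight x y 1) N ∈ families := by
  rw [mem_families_iff]
  have hmem (n : ℕ) := mem_lengthSet_theta_right_le_one (x := x) (n := n)
    (m := (N - 2 * y - min x (y + 1)) / 2) hy hy (by omega) (show N = _ by omega)
  obtain rfl | rfl : y = 0 ∨ y = 1 := by omega
  · exact .inl <| mem_family1_iff.2 ⟨(N - 2 * 0 - min x (0 + 1)) / 2,
      fun n => (hmem n).trans (by omega)⟩
  · exact .inr <| .inr <| .inl <| mem_family3_iff.2 ⟨_, min x (1 + 1) / 2, by omega, by omega,
      by omega, by omega, hmem⟩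

theorem lengthSet_theta_mem_families (hgap : ¬(2 ≤ x ∧ 2 ≤ z ∧ y < x + z))
    (hxyz : (x + y + z) % 2 = 0) (hN : N % 2 = x % 2) (hle : 2 * x + 3 * y + z ≤ N) :
    lengthSet (ThetaWeight x y z) N ∈ families := by
  rw [mem_families_iff]
  rcases Nat.eq_zero_or_pos z with rfl | hz
  · have := lengthSet_theta_zero_mem_family2 (by omega) hN hle
    tauto
  by_cases hx : x ≤ 1
  · have := lengthSet_theta_mem_family4 hx (by omega) hxyz hN hle
    tauto
  obtain rfl | hz2 : z = 1 ∨ 2 ≤ z := by omega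
  · by_cases hy : y ≤ 1
    · exact mem_families_iff.1 <|
        lengthSet_theta_one_mem_families_of_le_one (by omega) hy (by omega) hN hle
    obtain hxy | hxy : x < y ∨ y < x := by omega
    · have := lengthSet_theta_one_mem_family8 (by omega) hxy (by omega) hN hle
      tauto
    · have := lengthSet_theta_one_mem_family7 (by omega) hxy (by omega) hN hle
      tauto
  · have := lengthSet_theta_mem_family6 (by omega) hz2 hxyz (by omega) hN hle
    tauto

end Classification

theorem IsCircuit.dvd_of_hasWeight {G : Type*} [AddCommGroup G] {U : Finset G} {A : Multiset G}
    {w : ℕ} (hU : IsCircuit U) (hA : ∀ x ∈ A, x ∈ U) (hw : HasWeight A w) : U.card - 2 ∣ w := by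
  obtain ⟨F, hF, ⟨R, rfl⟩, rfl⟩ := hw
  have hFU : ∀ C ∈ F, C = U := fun C hC => hU.eq_of_subset (hF C hC).isCycle (hF C hC).nonempty
    fun x hx => hA x (Multiset.mem_add.2 (.inl (mem_cover.2 ⟨C, hC, hx⟩)))
  rw [Multiset.eq_replicate_card.2 hFU, weight_replicate]
  exact dvd_mul_left _ _

theorem HasWeight.add_four_le {G : Type*} [AddCommGroup G] [Module (ZMod 2) G] {A : Multiset G}
    {v w : ℕ} (hv : HasWeight A v) (hw : HasWeight A w) (hvw : v < w) : w + 4 ≤ A.card := by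
  classical
  obtain ⟨F, hF, ⟨R, rfl⟩, rfl⟩ := hw
  have hcard := card_cover hF
  have hF0 : F.card ≠ 0 := fun h => by simp [Multiset.card_eq_zero.1 h] at hvw
  rw [Multiset.card_add, Multiset.card_nsmul]
  by_contra hlt
  obtain rfl : R = 0 := Multiset.card_eq_zero.1 (by omega)
  obtain ⟨C, rfl⟩ := Multiset.card_eq_one.1 (show F.card = 1 by omega)
  have hC := hF C (Multiset.mem_singleton_self C)
  simp only [cover_singleton, weight_singleton, smul_zero, add_zero] at hv hvw
  have hv0 : v = 0 := Nat.eq_zero_of_dvd_of_lt (hC.dvd_of_hasWeight (fun _ => id) hv) hvw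
  obtain ⟨R', hR'⟩ := (hv0 ▸ hv).exists_eq_two_nsmul
  obtain ⟨x, hx⟩ := hC.nonempty
  have := congrArg (Multiset.count x) hR'
  rw [Multiset.count_nsmul, Multiset.count_eq_one_of_mem C.nodup hx] at this
  omega

theorem not_hasWeight_of_card_eq_ten {A : Multiset E4} (hA : A.card = 10) (h0 : HasWeight A 0)
    (h4 : HasWeight A 4) : ¬HasWeight A 6 := by
  rintro ⟨F, hF, ⟨R, rfl⟩, hw⟩
  have hcard := card_cover hF
  have h3 := weight_le_three_mul_card hF
  rw [Multiset.card_add, Multiset.card_nsmul, hcard] at hA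
  obtain rfl : R = 0 := Multiset.card_eq_zero.1 (by omega)
  obtain ⟨U, V, rfl⟩ := Multiset.card_eq_two.1 (show F.card = 2 by omega)
  have hU := hF U (by simp)
  have hV := hF V (by simp)
  have := hU.card_le_five
  have := hV.card_le_five
  simp only [Multiset.insert_eq_cons, weight_cons, weight_singleton] at hw
  simp only [Multiset.insert_eq_cons, cover_cons, cover_singleton, smul_zero, add_zero] at h0 h4
  obtain ⟨R, hR⟩ := h0.exists_eq_two_nsmul
  have hUV : U = V := by
    ext x
    have := congrArg (Multiset.count x) hR
    simp only [Multiset.count_add, Multiset.count_nsmul, count_val] at this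
    split_ifs at this <;> grind
  subst hUV
  have := hU.dvd_of_hasWeight (fun x hx => by simpa using hx) h4
  rw [show U.card - 2 = 3 by omega] at this
  omega

theorem HasWeight.exists_greatest {G : Type*} [AddCommGroup G] [Module (ZMod 2) G]
    {A : Multiset G} {w : ℕ}
    (hw : HasWeight A w) : ∃ c, HasWeight A c ∧ ∀ v, HasWeight A v → v ≤ c := by
  classical
  exact ⟨_, Nat.findGreatest_spec hw.le_card hw, fun v hv => Nat.le_findGreatest hv.le_card hv⟩

theorem lengthSet_mem_families_of_forall_sub_two {A : Multiset E4} (h0 : 0 ∉ A) (hs : A.sum = 0)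
    (j : ℕ) (hgap : ∀ w, HasWeight A w → (∃ v < w, HasWeight A v) → HasWeight A (w - 2)) :
    lengthSet (HasWeight A) (A.card + 2 * j) ∈ families := by
  classical
  obtain ⟨a, ha, hmin⟩ : ∃ a, HasWeight A a ∧ ∀ w, HasWeight A w → a ≤ w :=
    ⟨_, Nat.find_spec (exists_hasWeight h0 hs), fun w hw => Nat.find_min' _ hw⟩
  obtain ⟨c, hc, hmax⟩ := ha.exists_greatest
  have hac := hmax a ha
  have hpa := ha.mod_two
  have hpc := hc.mod_two
  have hcc := hc.five_mul_le
  have hmem (w : ℕ) : HasWeight A w ↔ a ≤ w ∧ w ≤ c ∧ w % 2 = c % 2 := by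
    refine ⟨fun hw => ⟨hmin w hw, hmax w hw, hw.mod_two.trans hpc.symm⟩, ?_⟩
    rintro ⟨haw, hwc, hpar⟩
    exact of_forall_sub_two hc (fun w hw haw _ => hgap w hw ⟨a, haw, ha⟩) haw hwc hpar
  have hL (n : ℕ) : n ∈ lengthSet (HasWeight A) (A.card + 2 * j) ↔
      (A.card + 2 * j - c) / 2 ≤ n ∧ n ≤ (A.card + 2 * j - c) / 2 + (c - a) / 2 := by
    refine ⟨fun ⟨w, hw, h⟩ => ?_, fun h => ⟨A.card + 2 * j - 2 * n, (hmem _).2 ?_, ?_⟩⟩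
    · have := (hmem w).1 hw
      omega
    all_goals omega
  rw [mem_families_iff]
  rcases hac.eq_or_lt with rfl | hac
  · exact .inl <| mem_family1_iff.2 ⟨(A.card + 2 * j - a) / 2, fun n => (hL n).trans (by omega)⟩
  · have := ha.add_four_le hc hac
    refine .inr <| .inr <| .inl <| mem_family3_iff.2
      ⟨_, (c - a) / 2, by omega, by omega, by omega, fun h3 => ?_, hL⟩
    by_contra hm
    obtain ⟨hcard, rfl, rfl⟩ : A.card = 10 ∧ c = 6 ∧ a = 0 := by omega
    exact not_hasWeight_of_card_eq_ten hcard ha ((hmem 4).2 (by omega)) hc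

theorem lengthSet_mem_families_of_thetaSupport {A : Multiset E4} (h0 : 0 ∉ A) (hs : A.sum = 0)
    (hA : ThetaSupport A) (j : ℕ) : lengthSet (HasWeight A) (A.card + 2 * j) ∈ families := by
  obtain ⟨P, Q, g, hθ, hmem⟩ := hA
  obtain ⟨x, y, z, hxyz, hle, hw⟩ := hθ.exists_hasWeight_iff hmem hs
  have hpar := ((hw _).2 ⟨x % 2, y % 2, by omega, by omega, by omega, by omega, by omega,
    by omega, rfl⟩).mod_two
  by_cases hgap : 2 ≤ x ∧ 2 ≤ z ∧ y < x + z
  · refine lengthSet_mem_families_of_forall_sub_two h0 hs j fun w hA ⟨v, hvw, hv⟩ => ?_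
    obtain ⟨p, q, hpq⟩ := (hw v).1 hv
    have hwθ := (hw w).1 hA
    refine (hw _).2 (hwθ.sub_two hgap.1 hgap.2.1 hxyz (by omega) ?_)
    obtain ⟨p', q', hpq'⟩ := hwθ
    omega
  · rw [show HasWeight A = ThetaWeight x y z from funext fun w => propext (hw w)]
    exact lengthSet_theta_mem_families hgap hxyz (by omega) (by omega)

theorem two_mul_weight_le {G : Type*} [AddCommGroup G] [Module (ZMod 2) G] {A : Multiset G}
    (h4 : ∀ C, IsCircuit C → (∀ x ∈ C, x ∈ A) → C.card = 4) {w : ℕ}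
    (hw : HasWeight A w) : 2 * w ≤ A.card := by
  obtain ⟨F, hF, ⟨R, rfl⟩, rfl⟩ := hw
  have hF4 : ∀ C ∈ F, C.card ≤ 2 + 2 := fun C hC =>
    (h4 C (hF C hC) fun x hx => Multiset.mem_add.2 (.inl (mem_cover.2 ⟨C, hC, hx⟩))).le
  have hcard := card_cover hF
  have hle := weight_le_mul_card hF4
  rw [Multiset.card_add]
  omega

theorem lengthSet_mem_families_of_gap_four {A : Multiset E4}
    (h4 : ∀ C, IsCircuit C → (∀ x ∈ C, x ∈ A) → C.card = 4) (hA0 : HasWeight A 0)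
    (hA2 : ¬HasWeight A 2) (hA4 : HasWeight A 4)
    (hstep : ∀ w, HasWeight A w → 4 < w → HasWeight A (w - 2)) (j : ℕ) :
    lengthSet (HasWeight A) (A.card + 2 * j) ∈ families := by
  obtain ⟨c, hc, hmax⟩ := hA4.exists_greatest
  have hcc := two_mul_weight_le h4 hc
  have hc4 := hmax 4 hA4
  have hp0 := hA0.mod_two
  have hpc := hc.mod_two
  have hmem (w : ℕ) : HasWeight A w ↔ w = 0 ∨ (4 ≤ w ∧ w ≤ c ∧ w % 2 = 0) := by
    refine ⟨fun hw => ?_, ?_⟩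
    · have hpw := hw.mod_two
      have hwc := hmax w hw
      have hw2 : w ≠ 2 := fun h => hA2 (h ▸ hw)
      omega
    · rintro (rfl | ⟨h4w, hwc, hpw⟩)
      · exact hA0
      · exact of_forall_sub_two hc (fun w hw h4w _ => hstep w hw h4w) h4w hwc (by omega)
  have hL (n : ℕ) : n ∈ lengthSet (HasWeight A) (A.card + 2 * j) ↔
      ((A.card + 2 * j - c) / 2 ≤ n ∧ n ≤ (A.card + 2 * j - c) / 2 + (c - 4) / 2) ∨
        n = (A.card + 2 * j - c) / 2 + (c - 4) / 2 + 2 := by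
    refine ⟨fun ⟨w, hw, h⟩ => ?_, fun h => ⟨A.card + 2 * j - 2 * n, (hmem _).2 ?_, ?_⟩⟩
    · have := (hmem w).1 hw
      omega
    all_goals omega
  rw [mem_families_iff]
  rcases hc4.eq_or_lt with rfl | hc4
  · have : lengthSet (HasWeight A) (A.card + 2 * j) ∈ family4 := mem_family4_iff.2
      ⟨(A.card + 2 * j - 4) / 2, 1, by omega, fun n => (hL n).trans
        ⟨fun h => ⟨(n - (A.card + 2 * j - 4) / 2) / 2, by omega, by omega⟩,
          fun ⟨i, hi, h⟩ => by omega⟩⟩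
    tauto
  · have : lengthSet (HasWeight A) (A.card + 2 * j) ∈ family5 :=
      mem_family5_iff.2 ⟨_, _, by omega, by omega, hL⟩
    tauto

theorem lengthSet_mem_families {A : Multiset E4} (h0 : 0 ∉ A) (hs : A.sum = 0) (j : ℕ) :
    lengthSet (HasWeight A) (A.card + 2 * j) ∈ families := by
  by_cases hθ : ThetaSupport A
  · exact lengthSet_mem_families_of_thetaSupport h0 hs hθ j
  have hgap {w : ℕ} (hw : HasWeight A w) (hlt : ∃ v < w, HasWeight A v)
      (hn : ¬HasWeight A (w - 2)) :=
    (thetaSupport_or_eq_two_nsmul_of_gap h0 hw hn hlt).resolve_left hθ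
  by_cases hstep : ∀ w, HasWeight A w → (∃ v < w, HasWeight A v) → HasWeight A (w - 2)
  · exact lengthSet_mem_families_of_forall_sub_two h0 hs j hstep
  push Not at hstep
  obtain ⟨w, hw, hlt, hn⟩ := hstep
  obtain ⟨rfl, ⟨Q, rfl⟩, h4⟩ := hgap hw hlt hn
  refine lengthSet_mem_families_of_gap_four h4 (hasWeight_two_nsmul Q) hn hw
    (fun v hv h4v => ?_) j
  by_contra hcon
  exact h4v.ne' (hgap hv ⟨4, h4v, hw⟩ hcon).1

theorem mem_lengthSystem_of_hasWeight {L : Set ℕ} {A : Multiset E4} (h0 : 0 ∉ A) (hs : A.sum = 0)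
    (j : ℕ) (hL : ∀ n, n ∈ L ↔ n ∈ lengthSet (HasWeight A) (A.card + 2 * j)) :
    L ∈ lengthSystem (zeroSumSequences E4) :=
  mem_lengthSystem_iff.2 ⟨A, j, h0, hs, Set.ext hL⟩

theorem IsCircuit.of_sum_eq_zero {G : Type*} [AddCommGroup G] [Module (ZMod 2) G] {C : Finset G}
    (hC : 0 ∉ C ∧ ∑ x ∈ C, x = 0 ∧ C.Nonempty ∧ C.card ≤ 5) : IsCircuit C :=
  IsCycle.isCircuit ⟨hC.1, hC.2.1⟩ hC.2.2.1 hC.2.2.2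

/-- The circuit formed by the standard basis and the sum of its elements. -/
def fiveCircuit : Finset E4 :=
  {![1, 0, 0, 0], ![0, 1, 0, 0], ![0, 0, 1, 0], ![0, 0, 0, 1], ![1, 1, 1, 1]}

theorem isCircuit_fiveCircuit : IsCircuit fiveCircuit := .of_sum_eq_zero (by decide +kernel)

theorem card_fiveCircuit : fiveCircuit.card = 5 := by decide +kernel

section Theta

theorem mem_lengthSystem_of_theta {L : Set ℕ} {x y z : ℕ} (hxyz : (x + y + z) % 2 = 0) (j : ℕ)
    (hL : ∀ n, n ∈ L ↔ n ∈ lengthSet (ThetaWeight x y z) (2 * x + 3 * y + z + 2 * j)) :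
    L ∈ lengthSystem (zeroSumSequences E4) := by
  obtain ⟨P, hP, hP2⟩ := Finset.exists_subset_card_eq
    (show 2 ≤ fiveCircuit.card by rw [card_fiveCircuit]; norm_num)
  have hθ := IsTheta.of_subset isCircuit_fiveCircuit card_fiveCircuit hP hP2 rfl
  set Q := fiveCircuit \ P
  set g := ∑ x ∈ P, x
  obtain ⟨hcP, hcQ, hcg⟩ := hθ.count_eq x y z
  have hmem : ∀ a ∈ thetaSeq P Q g x y z, a ∈ insert g (P ∪ Q) := fun a ha => by
    rw [← Multiset.one_le_count_iff_mem, count_thetaSeq] at ha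
    grind
  have hforall {S : Finset E4} (hS : S.Nonempty) {p' : ℕ}
      (hp : ∀ a ∈ S, (thetaSeq P Q g x y z).count a = p') (p : ℕ) :
      (∀ a ∈ S, p ≤ (thetaSeq P Q g x y z).count a ∧ p % 2 = (thetaSeq P Q g x y z).count a % 2) ↔
        p ≤ p' ∧ p % 2 = p' % 2 :=
    ⟨fun h => hS.elim fun a ha => hp a ha ▸ h a ha, fun h a ha => (hp a ha).symm ▸ h⟩
  have hw (w : ℕ) : HasWeight (thetaSeq P Q g x y z) w ↔ ThetaWeight x y z w := by
    simpa only [hcg] using hθ.hasWeight_iff hmem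
      (hforall (Finset.card_pos.1 (by rw [hθ.card_left]; norm_num)) hcP)
      (hforall (Finset.card_pos.1 (by rw [hθ.card_right]; norm_num)) hcQ) (by rwa [hcg])
  have hcard : (thetaSeq P Q g x y z).card = 2 * x + 3 * y + z := by
    simp only [thetaSeq, Multiset.card_add, Multiset.card_nsmul, Finset.card_val, hθ.card_left,
      hθ.card_right, Multiset.card_singleton]
    omega
  refine mem_lengthSystem_of_hasWeight (fun h0 => hθ.zero_notMem (hmem 0 h0))
    ((hw _).2 ⟨x % 2, y % 2, by omega, by omega, by omega, by omega, by omega, by omega,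
      rfl⟩).sum_eq_zero j fun n => ?_
  rw [hL, hcard, show HasWeight _ = ThetaWeight x y z from funext fun w => propext (hw w)]

variable {L : Set ℕ}

theorem mem_lengthSystem_of_mem_family1 (hL : L ∈ family1) :
    L ∈ lengthSystem (zeroSumSequences E4) := by
  obtain ⟨m, h⟩ := mem_family1_iff.1 hL
  refine mem_lengthSystem_of_theta (x := 0) (y := 0) (z := 0) rfl m fun n => (h n).trans ?_
  rw [mem_lengthSet_theta_zero (m := m) rfl (by omega)]
  exact ⟨fun h => ⟨0, by omega, by omega⟩, fun ⟨i, hi, h⟩ => by omega⟩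

theorem mem_lengthSystem_of_mem_family2 (hL : L ∈ family2) :
    L ∈ lengthSystem (zeroSumSequences E4) := by
  obtain ⟨m, k, hm, h⟩ := mem_family2_iff.1 hL
  refine mem_lengthSystem_of_theta (x := 2 * k) (y := 2 * k) (z := 0) (by omega) (m - 2 * k)
    fun n => (h n).trans ?_
  rw [mem_lengthSet_theta_zero (m := m) rfl (by omega), min_self,
    Nat.mul_div_cancel_left k two_pos]

theorem mem_lengthSystem_of_mem_family4 (hL : L ∈ family4) :
    L ∈ lengthSystem (zeroSumSequences E4) := by
  obtain ⟨m, k, hm, h⟩ := mem_family4_iff.1 hL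
  refine mem_lengthSystem_of_theta (x := 0) (y := 2 * k) (z := 2 * k) (by omega) (m - 2 * k)
    fun n => (h n).trans ?_
  rw [mem_lengthSet_theta_left_le_one (m := m) (by omega) (by omega) (by omega) (by omega),
    zero_add, min_self, Nat.mul_div_cancel_left k two_pos]

theorem mem_lengthSystem_of_mem_family6 (hL : L ∈ family6) :
    L ∈ lengthSystem (zeroSumSequences E4) := by
  obtain ⟨m, k, hk, hm, h⟩ := mem_family6_iff.1 hL
  obtain ⟨i, d, hik, hd, hdi, him⟩ : ∃ i d, k + d = 3 * i ∧ d ≤ 2 ∧ d < i ∧ 2 * i + 2 ≤ m :=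
    ⟨(k + 2) / 3, 3 * ((k + 2) / 3) - k, by omega⟩
  refine mem_lengthSystem_of_theta (x := 2 * i - 2 * d) (y := 2 * i + 2) (z := 2 + 2 * d)
    (by omega) (m - (2 * i + 2)) fun n => (h n).trans (mem_lengthSet_theta_large ?_ ?_ ?_ ?_ ?_
      ?_).symm <;> omega

theorem mem_lengthSystem_of_mem_family7 (hL : L ∈ family7) :
    L ∈ lengthSystem (zeroSumSequences E4) := by
  rcases mem_family7_iff.1 hL with ⟨m, k, hm, h⟩ | ⟨m, k, hm, h⟩
  · exact mem_lengthSystem_of_theta (x := 2 * k + 3) (y := 2 * k + 2) (z := 1) (by omega)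
      (m - (2 * k + 3)) fun n => (h n).trans
        (mem_lengthSet_theta_odd_gt (by omega) (by omega) (by omega)).symm
  · exact mem_lengthSystem_of_theta (x := 2 * k + 4) (y := 2 * k + 3) (z := 1) (by omega)
      (m - (2 * k + 4)) fun n => (h n).trans
        (mem_lengthSet_theta_even_gt (by omega) (by omega) (by omega)).symm

theorem mem_lengthSystem_of_mem_family8 (hL : L ∈ family8) :
    L ∈ lengthSystem (zeroSumSequences E4) := by
  rcases mem_family8_iff.1 hL with ⟨m, k, hm, h⟩ | ⟨m, k, hm, h⟩
  · exact mem_lengthSystem_of_theta (x := 2 * k + 2) (y := 2 * k + 3) (z := 1) (by omega)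
      (m - (2 * k + 3)) fun n => (h n).trans
        (mem_lengthSet_theta_even_lt (by omega) (by omega) (by omega)).symm
  · exact mem_lengthSystem_of_theta (x := 2 * k + 3) (y := 2 * k + 4) (z := 1) (by omega)
      (m - (2 * k + 4)) fun n => (h n).trans
        (mem_lengthSet_theta_odd_lt (by omega) (by omega) (by omega)).symm

end Theta

/-! Let `U` be `fiveCircuit` and `V` be `exchangedCircuit`. The sequences `U + V`, `2 (U ∪ V)` and
`2 (U + V)` attain all weights of the right parity up to the bound of three fifths of the number of
terms. Two further copies of `U` raise this bound and the largest weight by six, so extending by an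
even number of copies of `U` keeps the set of lengths an interval. -/

/-- The circuit obtained from `fiveCircuit` by adding the third element to the first two. -/
def exchangedCircuit : Finset E4 :=
  {![1, 0, 1, 0], ![0, 1, 1, 0], ![0, 0, 1, 0], ![0, 0, 0, 1], ![1, 1, 1, 1]}

theorem hasWeight_five_add_exchanged {e : ℕ} (he : e ≤ 2) :
    HasWeight (fiveCircuit.val + exchangedCircuit.val) (2 + 2 * e) := by
  interval_cases e
  · refine ⟨{fiveCircuit ∆ exchangedCircuit}, ?_, ⟨(fiveCircuit ∩ exchangedCircuit).val, ?_⟩, ?_⟩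
    · simpa using IsCircuit.of_sum_eq_zero (by decide +kernel)
    all_goals decide +kernel
  · refine ⟨{{![1, 0, 1, 0], ![0, 1, 0, 0], ![0, 0, 0, 1], ![1, 1, 1, 1]},
      {![0, 1, 1, 0], ![1, 0, 0, 0], ![0, 0, 0, 1], ![1, 1, 1, 1]}}, ?_,
      ⟨{![0, 0, 1, 0]}, by decide +kernel⟩, by decide +kernel⟩
    simpa using ⟨IsCircuit.of_sum_eq_zero (by decide +kernel),
      IsCircuit.of_sum_eq_zero (by decide +kernel)⟩
  · exact isCircuit_fiveCircuit.hasWeight.add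
      (IsCircuit.of_sum_eq_zero (C := exchangedCircuit) (by decide +kernel)).hasWeight

theorem IsCircuit.hasWeight_two_nsmul {G : Type*} [AddCommGroup G] {C : Finset G} {A : Multiset G}
    (hC : IsCircuit C) (h : C.val ≤ A) :
    HasWeight (2 • A) (2 * (C.card - 2)) := by
  obtain ⟨R, rfl⟩ := Multiset.le_iff_exists_add.1 h
  rw [nsmul_add]
  exact (hC.hasWeight.nsmul 2).add_two_nsmul R

theorem hasWeight_two_nsmul_union {e : ℕ} (he : e ≤ 4) :
    HasWeight (2 • (fiveCircuit ∪ exchangedCircuit).val) (0 + 2 * e) := by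
  interval_cases e
  · exact hasWeight_two_nsmul _
  · exact (IsCircuit.of_sum_eq_zero (G := E4)
      (C := {![1, 0, 0, 0], ![0, 0, 1, 0], ![1, 0, 1, 0]}) (by decide +kernel)).hasWeight_two_nsmul
        (by decide +kernel)
  · exact (IsCircuit.of_sum_eq_zero (C := fiveCircuit ∆ exchangedCircuit)
      (by decide +kernel)).hasWeight_two_nsmul (by decide +kernel)
  · exact isCircuit_fiveCircuit.hasWeight_two_nsmul (by decide +kernel)
  · have h := (hasWeight_five_add_exchanged le_rfl).add (IsCircuit.of_sum_eq_zero
      (C := fiveCircuit ∆ exchangedCircuit) (by decide +kernel)).hasWeight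
    convert h using 1 <;> decide +kernel

theorem hasWeight_two_nsmul_add {e : ℕ} (he : e ≤ 6) :
    HasWeight (2 • (fiveCircuit.val + exchangedCircuit.val)) (0 + 2 * e) := by
  by_cases h0 : e = 0
  · rw [h0]
    exact hasWeight_two_nsmul _
  by_cases h1 : e = 1
  · rw [h1]
    exact (IsCircuit.of_sum_eq_zero (G := E4)
      (C := {![1, 0, 0, 0], ![0, 0, 1, 0], ![1, 0, 1, 0]}) (by decide +kernel)).hasWeight_two_nsmul
        (by decide +kernel)
  have h := (hasWeight_five_add_exchanged (e := (e - 2) / 2) (by omega)).add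
    (hasWeight_five_add_exchanged (e := (e - 1) / 2) (by omega))
  rwa [← two_nsmul, show 2 + 2 * ((e - 2) / 2) + (2 + 2 * ((e - 1) / 2)) = 0 + 2 * e by omega] at h

theorem HasWeight.add_even_copies {G : Type*} [AddCommGroup G] {U : Finset G} {B : Multiset G}
    {a c : ℕ} (hU : IsCircuit U) (hU5 : U.card = 5) (hc : 2 ≤ c)
    (hB : ∀ e ≤ c, HasWeight B (a + 2 * e)) (i : ℕ) :
    ∀ e ≤ c + 3 * i, HasWeight (B + 2 • i • U.val) (a + 2 * e) := by
  induction i with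
  | zero => simpa using hB
  | succ i ih =>
    intro e he
    rw [succ_nsmul U.val i, nsmul_add, ← add_assoc]
    rcases le_or_gt e (c + 3 * i) with hle | hgt
    · exact (ih e hle).add_two_nsmul _
    · have h := (ih (e - 3) (by omega)).add (hU.hasWeight.nsmul 2)
      rwa [hU5, show a + 2 * (e - 3) + 2 * (5 - 2) = a + 2 * e by omega] at h

theorem mem_lengthSystem_of_interval {L : Set ℕ} {B : Multiset E4} {a c m j : ℕ} (i : ℕ)
    (h0 : 0 ∉ B) (hc : 2 ≤ c) (hB : ∀ e ≤ c, HasWeight B (a + 2 * e))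
    (hcard : 3 * B.card < 5 * (a + 2 * c + 2))
    (hlow : ∀ w, HasWeight (B + 2 • i • fiveCircuit.val) w → a ≤ w)
    (hm : 2 * m + a + 2 * c = B.card + 4 * i + 2 * j)
    (hL : ∀ n, n ∈ L ↔ m ≤ n ∧ n ≤ m + (c + 3 * i)) : L ∈ lengthSystem (zeroSumSequences E4) := by
  have hW := HasWeight.add_even_copies isCircuit_fiveCircuit card_fiveCircuit hc hB i
  have hAcard : (B + 2 • i • fiveCircuit.val).card = B.card + 10 * i := by
    simp only [Multiset.card_add, Multiset.card_nsmul, Finset.card_val, card_fiveCircuit]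
    ring
  have h0A : 0 ∉ B + 2 • i • fiveCircuit.val := by
    rw [Multiset.mem_add, not_or]
    exact ⟨h0, fun h => isCircuit_fiveCircuit.isCycle.zero_notMem
      (Multiset.mem_of_mem_nsmul (Multiset.mem_of_mem_nsmul h))⟩
  refine mem_lengthSystem_of_hasWeight h0A (hW 0 (by omega)).sum_eq_zero j fun n => ?_
  rw [hL, hAcard]
  constructor
  · exact fun h => ⟨_, hW (m + (c + 3 * i) - n) (by omega), by omega⟩
  · rintro ⟨w, hw, h⟩
    have hwa := hlow w hw
    have hwc := hw.five_mul_le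
    omega

theorem not_hasWeight_zero_of_count_eq_one {G : Type*} [AddCommGroup G] [Module (ZMod 2) G]
    [DecidableEq G] {A B : Multiset G} {x : G} (hx : A.count x = 1) :
    ¬HasWeight (A + 2 • B) 0 := fun h => by
  obtain ⟨R, hR⟩ := h.exists_eq_two_nsmul
  have := congrArg (Multiset.count x) hR
  rw [Multiset.count_add, hx, Multiset.count_nsmul, Multiset.count_nsmul] at this
  omega

theorem mem_lengthSystem_of_mem_family3 {L : Set ℕ} (hL : L ∈ family3) :
    L ∈ lengthSystem (zeroSumSequences E4) := by
  obtain ⟨m, k, hk, hm, hk1, hk3, h⟩ := mem_family3_iff.1 hL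
  have hcard : (fiveCircuit.val + exchangedCircuit.val).card = 10 := by decide +kernel
  obtain ⟨i, rfl | rfl | rfl | rfl | rfl⟩ : ∃ i, k = 1 ∨ k = 3 ∨ k = 2 + 3 * i ∨ k = 4 + 3 * i ∨
      k = 6 + 3 * i := by
    obtain h | h | h : k % 3 = 0 ∨ k % 3 = 1 ∨ k % 3 = 2 := by omega
    exacts [⟨(k - 6) / 3, by omega⟩, ⟨(k - 4) / 3, by omega⟩, ⟨(k - 2) / 3, by omega⟩]
  · refine mem_lengthSystem_of_theta (x := 2) (y := 0) (z := 2) rfl (m - 2)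
      fun n => (h n).trans ?_
    rw [mem_lengthSet_theta_right_le_one (m := m) (by omega) (by omega) rfl (by omega)]
    rfl
  · refine mem_lengthSystem_of_theta (x := 2) (y := 2) (z := 2) rfl (m - 3)
      fun n => (h n).trans ?_
    rw [mem_lengthSet_theta]
    exact ⟨fun h => ⟨2 * ((m + 3 - n) % 2), 2 * ((m + 3 - n) / 2), by omega⟩,
      fun ⟨p, q, h⟩ => by omega⟩
  · refine mem_lengthSystem_of_interval i (by decide +kernel) le_rfl
      (fun e he => hasWeight_five_add_exchanged he) (by omega) (fun w hw => ?_)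
      (j := m - (2 * i + 2)) (by omega) h
    have hpar := hw.mod_two
    have hw0 : w ≠ 0 := fun h0 => not_hasWeight_zero_of_count_eq_one (x := ![1, 0, 0, 0])
      (by decide +kernel) (h0 ▸ hw)
    simp only [Multiset.card_add, Multiset.card_nsmul] at hpar hcard
    omega
  · have hcard2 : (2 • (fiveCircuit ∪ exchangedCircuit).val).card = 14 := by decide +kernel
    exact mem_lengthSystem_of_interval i (by decide +kernel) (by omega)
      (fun e he => hasWeight_two_nsmul_union he) (by omega) (fun w _ => Nat.zero_le w)
      (j := m - (2 * i + 3)) (by omega) h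
  · have hcard2 : (2 • (fiveCircuit.val + exchangedCircuit.val)).card = 20 := by
      rw [Multiset.card_nsmul, hcard]
    exact mem_lengthSystem_of_interval i (by decide +kernel) (by omega)
      (fun e he => hasWeight_two_nsmul_add he) (by omega) (fun w _ => Nat.zero_le w)
      (j := m - (2 * i + 4)) (by omega) h

/-- Three disjoint pairs with the same sum, in the hyperplane of vectors with coordinate sum `1`.
All circuits in their union have four elements. -/
def parallelPair : Fin 3 → Finset E4 :=
  ![{![1, 0, 0, 0], ![0, 1, 0, 0]}, {![0, 0, 1, 0], ![1, 1, 1, 0]}, {![0, 0, 0, 1], ![1, 1, 0, 1]}]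

/-- The sequence in which the elements of the three parallel pairs have multiplicities `x`, `y`
and `z`. -/
def pairsSeq (x y z : ℕ) : Multiset E4 :=
  x • (parallelPair 0).val + y • (parallelPair 1).val + z • (parallelPair 2).val

theorem card_pairsSeq (x y z : ℕ) : (pairsSeq x y z).card = 2 * (x + y + z) := by
  have hcard : ∀ i, (parallelPair i).card = 2 := by decide +kernel
  simp only [pairsSeq, Multiset.card_add, Multiset.card_nsmul, Finset.card_val, hcard]
  ring

theorem sum_apply_eq_one_of_mem_pairsSeq {x y z : ℕ} {a : E4} (ha : a ∈ pairsSeq x y z) :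
    ∑ i, a i = 1 := by
  have hpair : ∀ i, ∀ a ∈ parallelPair i, ∑ i, a i = 1 := by decide +kernel
  simp only [pairsSeq, Multiset.mem_add] at ha
  rcases ha with (ha | ha) | ha <;> exact hpair _ a (Multiset.mem_of_mem_nsmul ha)

theorem IsCycle.even_card {G : Type*} [AddCommGroup G] {C : Finset G} (hC : IsCycle C)
    (f : G →+ ZMod 2) (hf : ∀ x ∈ C, f x = 1) : Even C.card := by
  rw [← ZMod.natCast_eq_zero_iff_even, ← map_zero f, ← hC.sum_eq_zero, map_sum,
    Finset.sum_congr rfl hf, Finset.sum_const, nsmul_one]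

theorem card_eq_four_of_subset_pairsSeq {x y z : ℕ} {C : Finset E4} (hC : IsCircuit C)
    (hCs : ∀ a ∈ C, a ∈ pairsSeq x y z) : C.card = 4 := by
  have heven := hC.isCycle.even_card (∑ i, Pi.evalAddMonoidHom (fun _ : Fin 4 => ZMod 2) i)
    fun a ha => by simpa using sum_apply_eq_one_of_mem_pairsSeq (hCs a ha)
  have h3 := hC.three_le_card
  have h5 := hC.card_le_five
  obtain ⟨c, hc⟩ := heven
  omega

theorem hasWeight_parallelPair_add {i j : Fin 3} (hij : i ≠ j) :
    HasWeight ((parallelPair i).val + (parallelPair j).val) 2 := by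
  have hunion : ∀ i j, i ≠ j → (0 ∉ parallelPair i ∪ parallelPair j ∧
      ∑ x ∈ parallelPair i ∪ parallelPair j, x = 0 ∧ (parallelPair i ∪ parallelPair j).Nonempty ∧
      (parallelPair i ∪ parallelPair j).card ≤ 5) ∧
      (parallelPair i ∪ parallelPair j).val = (parallelPair i).val + (parallelPair j).val ∧
      (parallelPair i ∪ parallelPair j).card = 4 := by decide +kernel
  obtain ⟨hC, hval, hcard⟩ := hunion i j hij
  have h := (IsCircuit.of_sum_eq_zero hC).hasWeight
  rwa [hval, hcard] at h

theorem hasWeight_pairsSeq (s t u a b c : ℕ) :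
    HasWeight (pairsSeq (s + t + 2 * a) (s + u + 2 * b) (t + u + 2 * c)) (2 * (s + t + u)) := by
  have h01 := (hasWeight_parallelPair_add (i := 0) (j := 1) (by decide)).nsmul s
  have h02 := (hasWeight_parallelPair_add (i := 0) (j := 2) (by decide)).nsmul t
  have h12 := (hasWeight_parallelPair_add (i := 1) (j := 2) (by decide)).nsmul u
  convert ((h01.add h02).add h12).add_two_nsmul (pairsSeq a b c) using 1
  · simp only [pairsSeq, add_nsmul, nsmul_add, mul_nsmul']
    abel
  · ring

theorem hasWeight_two_nsmul_pairsSeq {k e : ℕ} (he : e ≤ k + 2) (he1 : e ≠ 1) :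
    HasWeight (2 • pairsSeq ((k + 2) / 2) ((k + 1) / 2) 1) (2 * e) := by
  obtain ⟨s, t, u, a, b, c, hx, hy, hz, rfl⟩ : ∃ s t u a b c, 2 * ((k + 2) / 2) = s + t + 2 * a ∧
      2 * ((k + 1) / 2) = s + u + 2 * b ∧ 2 * 1 = t + u + 2 * c ∧ e = s + t + u := by
    rcases Nat.eq_zero_or_pos e with rfl | h0
    · exact ⟨0, 0, 0, (k + 2) / 2, (k + 1) / 2, 1, by omega⟩
    rcases Nat.mod_two_eq_zero_or_one e with hpar | hpar
    · exact ⟨e - 2, 2, 0, (k + 2) / 2 - e / 2, (k + 1) / 2 - (e - 2) / 2, 0, by omega⟩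
    · exact ⟨e - 2, 1, 1, (k + 2) / 2 - (e - 1) / 2, (k + 1) / 2 - (e - 1) / 2, 0, by omega⟩
  convert hasWeight_pairsSeq s t u a b c using 1
  rw [← hx, ← hy, ← hz]
  simp only [pairsSeq, nsmul_add, mul_nsmul']

theorem not_hasWeight_two_nsmul_two {G : Type*} [AddCommGroup G] [Module (ZMod 2) G]
    {Q : Multiset G} (h4 : ∀ C, IsCircuit C → (∀ x ∈ C, x ∈ 2 • Q) → C.card = 4) :
    ¬HasWeight (2 • Q) 2 := by
  classical
  rintro ⟨F, hF, ⟨R, hR⟩, hw⟩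
  have hcard := card_cover hF
  have hF4 : ∀ C ∈ F, C.card = 4 := fun C hC => h4 C (hF C hC) fun x hx =>
    hR ▸ Multiset.mem_add.2 (.inl (mem_cover.2 ⟨C, hC, hx⟩))
  have hwF : F.card * 2 = weight F := by
    rw [weight, Multiset.map_congr rfl fun C hC => by rw [hF4 C hC], Multiset.map_const',
      Multiset.sum_replicate, smul_eq_mul]
  obtain ⟨C, rfl⟩ := Multiset.card_eq_one.1 (show F.card = 1 by omega)
  obtain ⟨x, hx⟩ := (hF C (Multiset.mem_singleton_self C)).nonempty
  have := congrArg (Multiset.count x) hR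
  rw [cover_singleton, Multiset.count_add, Multiset.count_nsmul, Multiset.count_nsmul,
    Multiset.count_eq_one_of_mem C.nodup hx] at this
  omega

theorem mem_lengthSystem_of_mem_family5 {L : Set ℕ} (hL : L ∈ family5) :
    L ∈ lengthSystem (zeroSumSequences E4) := by
  obtain ⟨m, k, hk, hm, h⟩ := mem_family5_iff.1 hL
  set A := pairsSeq ((k + 2) / 2) ((k + 1) / 2) 1
  have hcard : (2 • A).card = 4 * k + 8 := by
    rw [Multiset.card_nsmul, card_pairsSeq]
    omega
  have h4 : ∀ C, IsCircuit C → (∀ a ∈ C, a ∈ 2 • A) → C.card = 4 := fun C hC hCs =>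
    card_eq_four_of_subset_pairsSeq hC fun a ha => Multiset.mem_of_mem_nsmul (hCs a ha)
  have h0 : 0 ∉ 2 • A := fun h => by
    simpa using sum_apply_eq_one_of_mem_pairsSeq (Multiset.mem_of_mem_nsmul h)
  refine mem_lengthSystem_of_hasWeight h0 (hasWeight_two_nsmul A).sum_eq_zero (m - (k + 2))
    fun n => ?_
  rw [h, hcard]
  constructor
  · exact fun hn => ⟨_, hasWeight_two_nsmul_pairsSeq (e := m + k + 2 - n) (by omega) (by omega),
      by omega⟩
  · rintro ⟨w, hw, hn⟩
    have hle := two_mul_weight_le h4 hw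
    have hw2 : w ≠ 2 := fun h2 => not_hasWeight_two_nsmul_two h4 (h2 ▸ hw)
    omega

theorem lengthSystem_eq : lengthSystem (zeroSumSequences E4) = families := by
  ext L
  constructor
  · intro hL
    obtain ⟨B, y, h0, hs, rfl⟩ := mem_lengthSystem_iff.1 hL
    exact lengthSet_mem_families h0 hs y
  · rw [mem_families_iff]
    rintro (h | h | h | h | h | h | h | h)
    exacts [mem_lengthSystem_of_mem_family1 h, mem_lengthSystem_of_mem_family2 h,
      mem_lengthSystem_of_mem_family3 h, mem_lengthSystem_of_mem_family4 h,
      mem_lengthSystem_of_mem_family5 h, mem_lengthSystem_of_mem_family6 h,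
      mem_lengthSystem_of_mem_family7 h, mem_lengthSystem_of_mem_family8 h]

theorem family3_eq_family3' : family3 = family3' :=
  Set.ext fun _ => mem_family3_iff.trans mem_family3'_iff.symm

end SetsOfLengths

theorem theorem4p8 :
    SetsOfLengths.lengthSystem (SetsOfLengths.zeroSumSequences (Fin 4 → ZMod 2)) =
      SetsOfLengths.family1 ∪ SetsOfLengths.family2 ∪ SetsOfLengths.family3 ∪
      SetsOfLengths.family4 ∪ SetsOfLengths.family5 ∪ SetsOfLengths.family6 ∪
      SetsOfLengths.family7 ∪ SetsOfLengths.family8 ∧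
    SetsOfLengths.family3 = SetsOfLengths.family3' :=
  ⟨SetsOfLengths.lengthSystem_eq, SetsOfLengths.family3_eq_family3'⟩
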